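/- **Cells.** An $n$-prepolygraph consists of sets of $i$-generators ($i\le n$) with sources and targets (parallel for $i\ge 2$) in the free $(i-1)$-precategory on the generators of lower dimension. ($\circ_i$ is composition in diagrammatic order. In a precategory, which is a sesquicategory in all dimensions, an $i$-cell composes along $\circ_{j}$, $j<i-1$, only with $(j+1)$-cells, and no interchange law is imposed.) Thus every 1-cell is a path of 1-generators. Every 2-cell is uniquely a $\circ_1$-composable sequence $w_1\circ_1\cdots\circ_1 w_k$ of whiskers $w_i=l_i\circ_0\alpha_i\circ_0 r_i$ ($\alpha_i$ a 2-generator, $l_i,r_i$ 1-cells). Every 3-cell is uniquely a $\circ_2$-composable sequence of whiskers $\lambda\circ_1(l\circ_0A\circ_0r)\circ_1\rho$ ($A$ a 3-generator, $l,r$ 1-cells, $\lambda,\rho$ 2-cells). Write $\Rightarrow$ for 2-cells, $\Rrightarrow$ for 3-cells. **Gray presentation.** A *Gray presentation* is a 4-prepolygraph $Q$ with the following generators, and possibly others. * *Interchange generators*: for all 2-generators $\alpha:f\Rightarrow f'$, $\beta:h\Rightarrow h'$ and every 1-cell $g$ such that $\alpha,g,\beta$ are 0-composable, a 3-generator $$X_{\alpha,g,\beta}:(\alpha\circ_0g\circ_0h)\circ_1(f'\circ_0g\circ_0\beta)\Rrightarrow(f\circ_0g\circ_0\beta)\circ_1(\alpha\circ_0g\circ_0h').$$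 For whiskers $w=l\circ_0\alpha\circ_0r$ and $v=l'\circ_0\beta\circ_0r'$ put $X_{w,v}=l\circ_0X_{\alpha,\,r\circ_0l',\,\beta}\circ_0r'$. For 0-composable 2-cells $\varphi=w_1\circ_1\cdots\circ_1w_k:f\Rightarrow f'$ and $\psi=v_1\circ_1\cdots\circ_1v_m:h\Rightarrow h'$, let $$X_{\varphi,\psi}:(\varphi\circ_0h)\circ_1(f'\circ_0\psi)\Rrightarrow(f\circ_0\psi)\circ_1(\varphi\circ_0h')$$ be the composite of whiskered 3-cells $X_{w_i,v_j}$ that moves $w_k$ past $v_1,\dots,v_m$ in this order, then $w_{k-1}$ past $v_1,\dots,v_m$, and so on until $w_1$ (an identity if $k=0$ or $m=0$). * *Independence generators*: for all 3-generators $A_i:\varphi_i\Rrightarrow\varphi_i'$ ($i=1,2$), 1-cells $l_i,r_i$ and 2-cells $\chi$ for which the composites make sense, a 4-generator from $$\big((l_1\circ_0A_1\circ_0r_1)\circ_1\chi\circ_1(l_2\circ_0\varphi_2\circ_0r_2)\big)\circ_2\big((l_1\circ_0\varphi_1'\circ_0r_1)\circ_1\chi\circ_1(l_2\circ_0A_2\circ_0r_2)\big)$$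 to $$\big((l_1\circ_0\varphi_1\circ_0r_1)\circ_1\chi\circ_1(l_2\circ_0A_2\circ_0r_2)\big)\circ_2\big((l_1\circ_0A_1\circ_0r_1)\circ_1\chi\circ_1(l_2\circ_0\varphi_2'\circ_0r_2)\big).$$ * *Interchange naturality generators*: for every 3-generator $A:\varphi\Rrightarrow\varphi':f\Rightarrow f'$, 1-cell $g$ and 2-generator $\beta:h\Rightarrow h'$ that are 0-composable, a 4-generator from $$\big((A\circ_0g\circ_0h)\circ_1(f'\circ_0g\circ_0\beta)\big)\circ_2X_{\varphi',\,g\circ_0\beta}\quad\text{to}\quad X_{\varphi,\,g\circ_0\beta}\circ_2\big((f\circ_0g\circ_0\beta)\circ_1(A\circ_0g\circ_0h')\big);$$ and for every 2-generator $\alpha:f\Rightarrow f'$, 1-cell $g$ and 3-generator $B:\psi\Rrightarrow\psi':h\Rightarrow h'$ that are 0-composable, a 4-generator from $$\big((\alpha\circ_0g\circ_0h)\circ_1(f'\circ_0g\circ_0B)\big)\circ_2X_{\alpha\circ_0g,\,\psi'}\quad\text{to}\quad X_{\alpha\circ_0g,\,\psi}\circ_2\big((f\circ_0g\circ_0B)\circ_1(\alpha\circ_0g\circ_0h')\big).$$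 **The rewriting system.** Let $P$ be the underlying 3-prepolygraph of $Q$, and let $\equiv$ be the smallest congruence (equivalence relation between parallel cells, compatible with $\circ_0,\circ_1,\circ_2$) on the 3-cells of the free 3-precategory on $P$ that relates the source and the target of each 4-generator of $Q$. The rewriting system of $Q$ is $(P,\equiv)$. A *rewriting step* is a 3-cell $\lambda\circ_1(l\circ_0A\circ_0r)\circ_1\rho$ with $A$ a 3-generator, $l,r$ 1-cells and $\lambda,\rho$ 2-cells. A *local branching* is a pair $(S_1,S_2)$ of rewriting steps with the same source. It is *confluent* if there are 3-cells $G_1,G_2$, composable with $S_1,S_2$ respectively and with the same target, such that $S_1\circ_2G_1\equiv S_2\circ_2G_2$. The system is *locally confluent* if every local branching is confluent. **Critical branchings.** A local branching $(S_1,S_2)$ is * *trivial* if $S_1=S_2$; * *minimal* if, whenever $S_i=\lambda\circ_1(l\circ_0S_i'\circ_0r)\circ_1\rho$ for $i=1,2$, with $(S_1',S_2')$ a local branching, $l,r$ 1-cells and $\lambda,\rho$ 2-cells, then $l,r,\lambda,\rho$ are identities; * *independent* if $S_1=(l_1\circ_0A_1\circ_0r_1)\circ_1\chi\circ_1(l_2\circ_0\varphi_2\circ_0r_2)$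 and $S_2=(l_1\circ_0\varphi_1\circ_0r_1)\circ_1\chi\circ_1(l_2\circ_0A_2\circ_0r_2)$ for some 3-generators $A_i:\varphi_i\Rrightarrow\varphi_i'$, 1-cells $l_i,r_i$ and a 2-cell $\chi$; * *natural* if one of the following holds: * $S_1=(A\circ_0g\circ_0h)\circ_1(f'\circ_0\psi)$ for some 3-generator $A:\varphi\Rrightarrow\varphi':f\Rightarrow f'$, 1-cell $g$ and 2-cell $\psi$ with source $g\circ_0h$ that is of the form $g\circ_0\psi_1$ with $\psi_1$ of source $h$, or * $S_1=(\varphi\circ_0h)\circ_1(f'\circ_0B)$ for some 3-generator $B:\psi\Rrightarrow\psi'$ with $\psi:h\Rightarrow h'$, and 2-cell $\varphi$ with target $f'$ that is of the form $\varphi_1\circ_0g$ with $\varphi_1$ a 2-cell and $g$ a 1-cell; and moreover, in either case, $\varphi=\varphi_0\circ_1w$ and $\psi=v\circ_1\psi_0$ with $w,v$ whiskers, and $S_2=(\varphi_0\circ_0\partial^-v)\circ_1X_{w,v}\circ_1(\partial^+w\circ_0\psi_0)$, where $\partial^-v$ is the source of $v$ and $\partial^+w$ the target of $w$; that is, $S_2$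 exchanges the last whisker of $\varphi$ with the first whisker of $\psi$; * *critical* if it is minimal and neither $(S_1,S_2)$ nor its symmetric branching $(S_2,S_1)$ is trivial, independent or natural. **Theorem (adapted critical pair lemma).** For every Gray presentation $Q$, the rewriting system $(P,\equiv)$ of $Q$ is locally confluent if and only if every critical branching is confluent. -/

import Mathlib

universe u

namespace GrayRewriting

/-! ## Free categories on graphs

Cells of a free precategory in dimension 2 and 3 are the morphisms of the free category on a graph
whose vertices are the cells one dimension below and whose edges are the whiskered generators. -/

/-- `IsPathFrom s t a [e₁, …, eₙ] b` : the edges `e₁, …, eₙ` form a path from `a` to `b` in the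
graph with source and target maps `s` and `t`. -/
def IsPathFrom {V E : Type u} (s t : E → V) : V → List E → V → Prop
  | a, [], b => a = b
  | a, e :: es, b => s e = a ∧ IsPathFrom s t (t e) es b

/-- A morphism of the free category on the graph with source and target maps `s, t : E → V`,
together with its source and target. -/
structure FreeMor {V E : Type u} (s t : E → V) where
  src : V
  tgt : V
  steps : List E
  isPath : IsPathFrom s t src steps tgt

section FreeMor

variable {V E : Type u} {s t : E → V}

theorem IsPathFrom.append {es es' : List E} {a b c : V} (h : IsPathFrom s t a es b)
    (h' : IsPathFrom s t b es' c) : IsPathFrom s t a (es ++ es') c := by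
  induction es generalizing a with
  | nil => cases h; exact h'
  | cons e es ih => exact ⟨h.1, ih h.2⟩

theorem IsPathFrom.tgt_unique {es : List E} {a b c : V} (h : IsPathFrom s t a es b)
    (h' : IsPathFrom s t a es c) : b = c := by
  induction es generalizing a with
  | nil => cases h; exact h'
  | cons e es ih => exact ih h.2 h'.2

theorem FreeMor.ext' {p q : FreeMor s t} (h : p.src = q.src) (h' : p.steps = q.steps) : p = q := by
  obtain ⟨a, b, es, hp⟩ := p
  obtain ⟨a', b', es', hq⟩ := q
  cases h
  cases h'
  cases hp.tgt_unique hq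
  rfl

/-- The identity of `a`. -/
def FreeMor.id (s t : E → V) (a : V) : FreeMor s t := ⟨a, a, [], rfl⟩

/-- Composition, in diagrammatic order. -/
def FreeMor.comp (p q : FreeMor s t) (h : p.tgt = q.src) : FreeMor s t where
  src := p.src
  tgt := q.tgt
  steps := p.steps ++ q.steps
  isPath := p.isPath.append (h ▸ q.isPath)

/-- An edge, as a morphism of the free category. -/
def FreeMor.edge (s t : E → V) (e : E) : FreeMor s t := ⟨s e, t e, [e], rfl, rfl⟩

@[simp] theorem FreeMor.id_src (a : V) : (FreeMor.id s t a).src = a := _root_.id rfl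
@[simp] theorem FreeMor.id_tgt (a : V) : (FreeMor.id s t a).tgt = a := _root_.id rfl
@[simp] theorem FreeMor.id_steps (a : V) : (FreeMor.id s t a).steps = [] := _root_.id rfl
@[simp] theorem FreeMor.edge_src (e : E) : (FreeMor.edge s t e).src = s e := _root_.id rfl
@[simp] theorem FreeMor.edge_tgt (e : E) : (FreeMor.edge s t e).tgt = t e := _root_.id rfl
@[simp] theorem FreeMor.edge_steps (e : E) : (FreeMor.edge s t e).steps = [e] := _root_.id rfl
@[simp] theorem FreeMor.comp_src (p q : FreeMor s t) (h) : (p.comp q h).src = p.src := _root_.id rfl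
@[simp] theorem FreeMor.comp_tgt (p q : FreeMor s t) (h) : (p.comp q h).tgt = q.tgt := _root_.id rfl
@[simp] theorem FreeMor.comp_steps (p q : FreeMor s t) (h) :
    (p.comp q h).steps = p.steps ++ q.steps := _root_.id rfl

end FreeMor

/-! ## Dimensions 0 and 1 -/

/-- A 1-prepolygraph: a set of 0-generators and a set of 1-generators between any two of them. -/
structure Prepolygraph1 where
  /-- The 0-generators, which are also the 0-cells. -/
  Obj : Type u
  /-- The 1-generators with given source and target. -/
  Gen1 : Obj → Obj → Type u

instance (P : Prepolygraph1.{u}) : Quiver.{u} P.Obj := ⟨P.Gen1⟩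

/-- The 1-cells `x → y` of the free precategory. -/
abbrev Cell1 (P : Prepolygraph1.{u}) (x y : P.Obj) : Type u := Quiver.Path x y

/-- The 1-cell is an identity. -/
inductive Cell1.IsId {P : Prepolygraph1.{u}} : ∀ {x y : P.Obj}, Cell1 P x y → Prop
  | nil (x : P.Obj) : Cell1.IsId (Quiver.Path.nil : Cell1 P x x)

/-! ## Dimension 2 -/

/-- A 2-prepolygraph. The 2-generators are sorted by their 0-source and 0-target. -/
structure Prepolygraph2 extends Prepolygraph1.{u} where
  Gen2 : Obj → Obj → Type u
  src2 : ∀ {x y : Obj}, Gen2 x y → Cell1 toPrepolygraph1 x y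
  tgt2 : ∀ {x y : Obj}, Gen2 x y → Cell1 toPrepolygraph1 x y

/-- A 2-dimensional whisker `l ∘₀ α ∘₀ r` between 1-cells `x → y`. -/
structure Whisker2 (P : Prepolygraph2.{u}) (x y : P.Obj) where
  {a b : P.Obj}
  l : Cell1 P.toPrepolygraph1 x a
  gen : P.Gen2 a b
  r : Cell1 P.toPrepolygraph1 b y

/-- The 1-source `l ∘₀ ∂⁻α ∘₀ r`. -/
def Whisker2.src {P : Prepolygraph2.{u}} {x y : P.Obj} (w : Whisker2 P x y) :
    Cell1 P.toPrepolygraph1 x y := w.l.comp ((P.src2 w.gen).comp w.r)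

/-- The 1-target `l ∘₀ ∂⁺α ∘₀ r`. -/
def Whisker2.tgt {P : Prepolygraph2.{u}} {x y : P.Obj} (w : Whisker2 P x y) :
    Cell1 P.toPrepolygraph1 x y := w.l.comp ((P.tgt2 w.gen).comp w.r)

/-- The 2-cells of the free precategory whose 0-source and 0-target are `x` and `y`, in normal
form: 1-composable sequences of 2-dimensional whiskers. `φ.src` and `φ.tgt` are the 1-source and
1-target, and `FreeMor.comp` is the composition `∘₁` of 2-cells. -/
abbrev Cell2 (P : Prepolygraph2.{u}) (x y : P.Obj) : Type u :=
  FreeMor (Whisker2.src (P := P) (x := x) (y := y)) Whisker2.tgt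

section Dim2

variable {P : Prepolygraph2.{u}}

/-- The 2-generator `α` as a 2-cell. -/
def Cell2.ofGen {x y : P.Obj} (α : P.Gen2 x y) : Cell2 P x y where
  src := P.src2 α
  tgt := P.tgt2 α
  steps := [⟨Quiver.Path.nil, α, Quiver.Path.nil⟩]
  isPath := by simp [IsPathFrom, Whisker2.src, Whisker2.tgt]

/-- The identity 2-cell of `f`. -/
def Cell2.id {x y : P.Obj} (f : Cell1 P.toPrepolygraph1 x y) : Cell2 P x y := FreeMor.id _ _ f

/-- A whisker as a 2-cell. -/
def Whisker2.toCell {x y : P.Obj} (w : Whisker2 P x y) : Cell2 P x y := FreeMor.edge _ _ w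

/-- The whisker `u ∘₀ w ∘₀ v`. -/
def Whisker2.whisk {x' x y y' : P.Obj} (u : Cell1 P.toPrepolygraph1 x' x) (w : Whisker2 P x y)
    (v : Cell1 P.toPrepolygraph1 y y') : Whisker2 P x' y' := ⟨u.comp w.l, w.gen, w.r.comp v⟩

@[simp] theorem Whisker2.whisk_src {x' x y y' : P.Obj} (u : Cell1 P.toPrepolygraph1 x' x)
    (w : Whisker2 P x y) (v : Cell1 P.toPrepolygraph1 y y') :
    (Whisker2.whisk u w v).src = u.comp (w.src.comp v) := by
  simp [Whisker2.whisk, Whisker2.src]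

@[simp] theorem Whisker2.whisk_tgt {x' x y y' : P.Obj} (u : Cell1 P.toPrepolygraph1 x' x)
    (w : Whisker2 P x y) (v : Cell1 P.toPrepolygraph1 y y') :
    (Whisker2.whisk u w v).tgt = u.comp (w.tgt.comp v) := by
  simp [Whisker2.whisk, Whisker2.tgt]

/-- The 2-cell `u ∘₀ φ ∘₀ v`. -/
def Cell2.whisk {x' x y y' : P.Obj} (u : Cell1 P.toPrepolygraph1 x' x) (φ : Cell2 P x y)
    (v : Cell1 P.toPrepolygraph1 y y') : Cell2 P x' y' where
  src := u.comp (φ.src.comp v)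
  tgt := u.comp (φ.tgt.comp v)
  steps := φ.steps.map fun w => Whisker2.whisk u w v
  isPath := by
    obtain ⟨f, g, ws, h⟩ := φ
    induction ws generalizing f with
    | nil => cases h; rfl
    | cons w ws ih =>
      obtain ⟨rfl, h⟩ := h
      refine ⟨by simp, ?_⟩
      simpa using ih _ h

@[simp] theorem Cell2.ofGen_src {x y : P.Obj} (α : P.Gen2 x y) :
    (Cell2.ofGen α).src = P.src2 α := _root_.id rfl
@[simp] theorem Cell2.ofGen_tgt {x y : P.Obj} (α : P.Gen2 x y) :
    (Cell2.ofGen α).tgt = P.tgt2 α := _root_.id rfl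
@[simp] theorem Cell2.id_src {x y : P.Obj} (f : Cell1 P.toPrepolygraph1 x y) :
    (Cell2.id f).src = f := _root_.id rfl
@[simp] theorem Cell2.id_tgt {x y : P.Obj} (f : Cell1 P.toPrepolygraph1 x y) :
    (Cell2.id f).tgt = f := _root_.id rfl
@[simp] theorem Whisker2.toCell_src {x y : P.Obj} (w : Whisker2 P x y) :
    w.toCell.src = w.src := _root_.id rfl
@[simp] theorem Whisker2.toCell_tgt {x y : P.Obj} (w : Whisker2 P x y) :
    w.toCell.tgt = w.tgt := _root_.id rfl
@[simp] theorem Cell2.whisk_src {x' x y y' : P.Obj} (u : Cell1 P.toPrepolygraph1 x' x)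
    (φ : Cell2 P x y) (v : Cell1 P.toPrepolygraph1 y y') :
    (Cell2.whisk u φ v).src = u.comp (φ.src.comp v) := _root_.id rfl
@[simp] theorem Cell2.whisk_tgt {x' x y y' : P.Obj} (u : Cell1 P.toPrepolygraph1 x' x)
    (φ : Cell2 P x y) (v : Cell1 P.toPrepolygraph1 y y') :
    (Cell2.whisk u φ v).tgt = u.comp (φ.tgt.comp v) := _root_.id rfl

/-- The 2-cell `λ ∘₁ φ ∘₁ ρ`. -/
def Cell2.ctx {x y : P.Obj} (lam φ rho : Cell2 P x y) (h₁ : lam.tgt = φ.src)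
    (h₂ : φ.tgt = rho.src) : Cell2 P x y :=
  (lam.comp φ h₁).comp rho h₂

@[simp] theorem Cell2.ctx_src {x y : P.Obj} (lam φ rho : Cell2 P x y) (h₁) (h₂) :
    (Cell2.ctx lam φ rho h₁ h₂).src = lam.src := _root_.id rfl
@[simp] theorem Cell2.ctx_tgt {x y : P.Obj} (lam φ rho : Cell2 P x y) (h₁) (h₂) :
    (Cell2.ctx lam φ rho h₁ h₂).tgt = rho.tgt := _root_.id rfl

@[simp] theorem Cell2.ctx_steps {x y : P.Obj} (lam φ rho : Cell2 P x y) (h₁) (h₂) :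
    (Cell2.ctx lam φ rho h₁ h₂).steps = lam.steps ++ (φ.steps ++ rho.steps) :=
  List.append_assoc _ _ _
@[simp] theorem Cell2.whisk_steps {x' x y y' : P.Obj} (u : Cell1 P.toPrepolygraph1 x' x)
    (φ : Cell2 P x y) (v : Cell1 P.toPrepolygraph1 y y') :
    (Cell2.whisk u φ v).steps = φ.steps.map fun w => Whisker2.whisk u w v := _root_.id rfl

theorem Cell2.whisk_whisk {x'' x' x y y' y'' : P.Obj} (u' : Cell1 P.toPrepolygraph1 x'' x')
    (u : Cell1 P.toPrepolygraph1 x' x) (φ : Cell2 P x y) (v : Cell1 P.toPrepolygraph1 y y')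
    (v' : Cell1 P.toPrepolygraph1 y' y'') :
    Cell2.whisk u' (Cell2.whisk u φ v) v' = Cell2.whisk (u'.comp u) φ (v.comp v') := by
  apply FreeMor.ext'
  · simp
  · simp [Cell2.whisk, Whisker2.whisk]

theorem Cell2.whisk_comp {x' x y y' : P.Obj} (u : Cell1 P.toPrepolygraph1 x' x)
    (φ ψ : Cell2 P x y) (h : φ.tgt = ψ.src) (v : Cell1 P.toPrepolygraph1 y y') :
    Cell2.whisk u (φ.comp ψ h) v =
      (Cell2.whisk u φ v).comp (Cell2.whisk u ψ v) (by simp [h]) := by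
  apply FreeMor.ext'
  · simp
  · simp [Cell2.whisk]

theorem Whisker2.toCell_eq {x y : P.Obj} (w : Whisker2 P x y) :
    w.toCell = Cell2.whisk w.l (Cell2.ofGen w.gen) w.r := by
  apply FreeMor.ext'
  · simp [Whisker2.src]
  · simp [Cell2.whisk, Cell2.ofGen, Whisker2.whisk, Whisker2.toCell]

end Dim2

/-! ## Dimension 3 -/

/-- A 3-prepolygraph: the 3-generators go between parallel 2-cells. -/
structure Prepolygraph3 extends Prepolygraph2.{u} where
  Gen3 : Obj → Obj → Type u
  src3 : ∀ {x y : Obj}, Gen3 x y → Cell2 toPrepolygraph2 x y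
  tgt3 : ∀ {x y : Obj}, Gen3 x y → Cell2 toPrepolygraph2 x y
  src_src3 : ∀ {x y : Obj} (A : Gen3 x y), (tgt3 A).src = (src3 A).src
  tgt_src3 : ∀ {x y : Obj} (A : Gen3 x y), (tgt3 A).tgt = (src3 A).tgt

attribute [simp] Prepolygraph3.src_src3 Prepolygraph3.tgt_src3

/-- A 3-dimensional whisker `λ ∘₁ (l ∘₀ A ∘₀ r) ∘₁ ρ`. -/
structure Whisker3 (P : Prepolygraph3.{u}) (x y : P.Obj) where
  {a b : P.Obj}
  lam : Cell2 P.toPrepolygraph2 x y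
  l : Cell1 P.toPrepolygraph1 x a
  gen : P.Gen3 a b
  r : Cell1 P.toPrepolygraph1 b y
  rho : Cell2 P.toPrepolygraph2 x y
  lam_tgt : lam.tgt = l.comp ((P.src3 gen).src.comp r)
  rho_src : l.comp ((P.src3 gen).tgt.comp r) = rho.src

/-- The 2-source `λ ∘₁ (l ∘₀ ∂⁻A ∘₀ r) ∘₁ ρ`. -/
def Whisker3.src {P : Prepolygraph3.{u}} {x y : P.Obj} (S : Whisker3 P x y) :
    Cell2 P.toPrepolygraph2 x y :=
  Cell2.ctx S.lam (Cell2.whisk S.l (P.src3 S.gen) S.r) S.rho (by simp [S.lam_tgt])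
    (by simp [S.rho_src])

/-- The 2-target `λ ∘₁ (l ∘₀ ∂⁺A ∘₀ r) ∘₁ ρ`. -/
def Whisker3.tgt {P : Prepolygraph3.{u}} {x y : P.Obj} (S : Whisker3 P x y) :
    Cell2 P.toPrepolygraph2 x y :=
  Cell2.ctx S.lam (Cell2.whisk S.l (P.tgt3 S.gen) S.r) S.rho (by simp [S.lam_tgt])
    (by simp [S.rho_src])

@[simp] theorem Whisker3.src_src {P : Prepolygraph3.{u}} {x y : P.Obj} (S : Whisker3 P x y) :
    S.src.src = S.lam.src := _root_.id rfl
@[simp] theorem Whisker3.src_tgt {P : Prepolygraph3.{u}} {x y : P.Obj} (S : Whisker3 P x y) :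
    S.src.tgt = S.rho.tgt := _root_.id rfl
@[simp] theorem Whisker3.src_steps {P : Prepolygraph3.{u}} {x y : P.Obj} (S : Whisker3 P x y) :
    S.src.steps =
      S.lam.steps ++ ((Cell2.whisk S.l (P.src3 S.gen) S.r).steps ++ S.rho.steps) :=
  Cell2.ctx_steps _ _ _ _ _
@[simp] theorem Whisker3.tgt_src {P : Prepolygraph3.{u}} {x y : P.Obj} (S : Whisker3 P x y) :
    S.tgt.src = S.lam.src := _root_.id rfl
@[simp] theorem Whisker3.tgt_tgt {P : Prepolygraph3.{u}} {x y : P.Obj} (S : Whisker3 P x y) :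
    S.tgt.tgt = S.rho.tgt := _root_.id rfl
@[simp] theorem Whisker3.tgt_steps {P : Prepolygraph3.{u}} {x y : P.Obj} (S : Whisker3 P x y) :
    S.tgt.steps =
      S.lam.steps ++ ((Cell2.whisk S.l (P.tgt3 S.gen) S.r).steps ++ S.rho.steps) :=
  Cell2.ctx_steps _ _ _ _ _

/-- The 3-cells of the free precategory whose 0-source and 0-target are `x` and `y`, in normal
form: 2-composable sequences of 3-dimensional whiskers. `F.src` and `F.tgt` are the 2-source and
2-target, and `FreeMor.comp` is the composition `∘₂` of 3-cells. -/
abbrev Cell3 (P : Prepolygraph3.{u}) (x y : P.Obj) : Type u :=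
  FreeMor (Whisker3.src (P := P) (x := x) (y := y)) Whisker3.tgt

section Dim3

variable {P : Prepolygraph3.{u}}

theorem IsPathFrom.parallel {x y : P.Obj} {φ φ' : Cell2 P.toPrepolygraph2 x y}
    {Ss : List (Whisker3 P x y)} (h : IsPathFrom Whisker3.src Whisker3.tgt φ Ss φ') :
    φ'.src = φ.src ∧ φ'.tgt = φ.tgt := by
  induction Ss generalizing φ with
  | nil => cases h; exact ⟨rfl, rfl⟩
  | cons S Ss ih =>
    obtain ⟨rfl, h⟩ := h
    obtain ⟨h₁, h₂⟩ := ih h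
    exact ⟨h₁, h₂⟩

@[simp] theorem Cell3.tgt_src {x y : P.Obj} (F : Cell3 P x y) : F.tgt.src = F.src.src :=
  F.isPath.parallel.1

@[simp] theorem Cell3.tgt_tgt {x y : P.Obj} (F : Cell3 P x y) : F.tgt.tgt = F.src.tgt :=
  F.isPath.parallel.2

theorem IsPathFrom.mem_parallel {x y : P.Obj} {φ φ' : Cell2 P.toPrepolygraph2 x y}
    {Ss : List (Whisker3 P x y)} (h : IsPathFrom Whisker3.src Whisker3.tgt φ Ss φ') :
    ∀ S ∈ Ss, S.lam.src = φ.src ∧ S.rho.tgt = φ.tgt := by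
  induction Ss generalizing φ with
  | nil => simp
  | cons S Ss ih =>
    obtain ⟨rfl, h⟩ := h
    intro T hT
    rcases List.mem_cons.1 hT with rfl | hT
    · exact ⟨rfl, rfl⟩
    · exact ih h T hT

/-- The 3-generator `A` as a 3-cell. -/
def Cell3.ofGen {x y : P.Obj} (A : P.Gen3 x y) : Cell3 P x y where
  src := P.src3 A
  tgt := P.tgt3 A
  steps := [⟨Cell2.id (P.src3 A).src, Quiver.Path.nil, A, Quiver.Path.nil,
    Cell2.id (P.src3 A).tgt, by simp, by simp⟩]
  isPath := by
    refine ⟨FreeMor.ext' ?_ ?_, FreeMor.ext' ?_ ?_⟩ <;>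
      simp [Cell2.id, Whisker2.whisk]

/-- The identity 3-cell of `φ`. -/
def Cell3.id {x y : P.Obj} (φ : Cell2 P.toPrepolygraph2 x y) : Cell3 P x y := FreeMor.id _ _ φ

/-- The whisker `u ∘₀ S ∘₀ v`. -/
def Whisker3.whisk {x' x y y' : P.Obj} (u : Cell1 P.toPrepolygraph1 x' x) (S : Whisker3 P x y)
    (v : Cell1 P.toPrepolygraph1 y y') : Whisker3 P x' y' where
  lam := Cell2.whisk u S.lam v
  l := u.comp S.l
  gen := S.gen
  r := S.r.comp v
  rho := Cell2.whisk u S.rho v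
  lam_tgt := by simp [S.lam_tgt]
  rho_src := by simp [← S.rho_src]

theorem Whisker3.whisk_src {x' x y y' : P.Obj} (u : Cell1 P.toPrepolygraph1 x' x)
    (S : Whisker3 P x y) (v : Cell1 P.toPrepolygraph1 y y') :
    (Whisker3.whisk u S v).src = Cell2.whisk u S.src v := by
  apply FreeMor.ext' <;> simp [Whisker3.whisk, Whisker2.whisk]

theorem Whisker3.whisk_tgt {x' x y y' : P.Obj} (u : Cell1 P.toPrepolygraph1 x' x)
    (S : Whisker3 P x y) (v : Cell1 P.toPrepolygraph1 y y') :
    (Whisker3.whisk u S v).tgt = Cell2.whisk u S.tgt v := by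
  apply FreeMor.ext' <;> simp [Whisker3.whisk, Whisker2.whisk]

/-- The 3-cell `u ∘₀ F ∘₀ v`. -/
def Cell3.whisk {x' x y y' : P.Obj} (u : Cell1 P.toPrepolygraph1 x' x) (F : Cell3 P x y)
    (v : Cell1 P.toPrepolygraph1 y y') : Cell3 P x' y' where
  src := Cell2.whisk u F.src v
  tgt := Cell2.whisk u F.tgt v
  steps := F.steps.map fun S => Whisker3.whisk u S v
  isPath := by
    obtain ⟨f, g, Ss, h⟩ := F
    induction Ss generalizing f with
    | nil => cases h; rfl
    | cons S Ss ih =>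
      obtain ⟨rfl, h⟩ := h
      refine ⟨Whisker3.whisk_src u S v, ?_⟩
      simpa [Whisker3.whisk_tgt] using ih _ h

/-- The whisker `μ ∘₁ S ∘₁ ν`. -/
def Whisker3.ctx {x y : P.Obj} (mu : Cell2 P.toPrepolygraph2 x y) (S : Whisker3 P x y)
    (nu : Cell2 P.toPrepolygraph2 x y) (h₁ : mu.tgt = S.lam.src) (h₂ : S.rho.tgt = nu.src) :
    Whisker3 P x y where
  lam := mu.comp S.lam h₁
  l := S.l
  gen := S.gen
  r := S.r
  rho := S.rho.comp nu h₂
  lam_tgt := by simp [S.lam_tgt]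
  rho_src := by simp [S.rho_src]

theorem Whisker3.ctx_src {x y : P.Obj} (mu : Cell2 P.toPrepolygraph2 x y) (S : Whisker3 P x y)
    (nu : Cell2 P.toPrepolygraph2 x y) (h₁ : mu.tgt = S.lam.src) (h₂ : S.rho.tgt = nu.src) :
    (Whisker3.ctx mu S nu h₁ h₂).src =
      Cell2.ctx mu S.src nu (by simp [h₁]) (by simp [h₂]) := by
  apply FreeMor.ext' <;> simp [Whisker3.ctx]

theorem Whisker3.ctx_tgt {x y : P.Obj} (mu : Cell2 P.toPrepolygraph2 x y) (S : Whisker3 P x y)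
    (nu : Cell2 P.toPrepolygraph2 x y) (h₁ : mu.tgt = S.lam.src) (h₂ : S.rho.tgt = nu.src) :
    (Whisker3.ctx mu S nu h₁ h₂).tgt =
      Cell2.ctx mu S.tgt nu (by simp [h₁]) (by simp [h₂]) := by
  apply FreeMor.ext' <;> simp [Whisker3.ctx]

/-- The 3-cell `μ ∘₁ F ∘₁ ν`. -/
def Cell3.ctx {x y : P.Obj} (mu : Cell2 P.toPrepolygraph2 x y) (F : Cell3 P x y)
    (nu : Cell2 P.toPrepolygraph2 x y) (h₁ : mu.tgt = F.src.src) (h₂ : F.src.tgt = nu.src) :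
    Cell3 P x y where
  src := Cell2.ctx mu F.src nu h₁ h₂
  tgt := Cell2.ctx mu F.tgt nu (by simp [h₁]) (by simp [h₂])
  steps := F.steps.pmap
    (fun S (hS : S.lam.src = F.src.src ∧ S.rho.tgt = F.src.tgt) =>
      Whisker3.ctx mu S nu (h₁.trans hS.1.symm) (hS.2.trans h₂))
    F.isPath.mem_parallel
  isPath := by
    obtain ⟨φ, φ', Ss, h⟩ := F
    induction Ss generalizing φ with
    | nil => cases h; rfl
    | cons S Ss ih =>
      obtain ⟨rfl, h⟩ := h
      refine ⟨Whisker3.ctx_src mu S nu h₁ h₂, ?_⟩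
      have := ih S.tgt h h₁ h₂
      rw [← Whisker3.ctx_tgt mu S nu h₁ h₂] at this
      exact this

@[simp] theorem Cell3.ofGen_src {x y : P.Obj} (A : P.Gen3 x y) :
    (Cell3.ofGen A).src = P.src3 A := _root_.id rfl
@[simp] theorem Cell3.ofGen_tgt {x y : P.Obj} (A : P.Gen3 x y) :
    (Cell3.ofGen A).tgt = P.tgt3 A := _root_.id rfl
@[simp] theorem Cell3.id_src {x y : P.Obj} (φ : Cell2 P.toPrepolygraph2 x y) :
    (Cell3.id φ).src = φ := _root_.id rfl
@[simp] theorem Cell3.id_tgt {x y : P.Obj} (φ : Cell2 P.toPrepolygraph2 x y) :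
    (Cell3.id φ).tgt = φ := _root_.id rfl
@[simp] theorem Cell3.whisk_src {x' x y y' : P.Obj} (u : Cell1 P.toPrepolygraph1 x' x)
    (F : Cell3 P x y) (v : Cell1 P.toPrepolygraph1 y y') :
    (Cell3.whisk u F v).src = Cell2.whisk u F.src v := _root_.id rfl
@[simp] theorem Cell3.whisk_tgt {x' x y y' : P.Obj} (u : Cell1 P.toPrepolygraph1 x' x)
    (F : Cell3 P x y) (v : Cell1 P.toPrepolygraph1 y y') :
    (Cell3.whisk u F v).tgt = Cell2.whisk u F.tgt v := _root_.id rfl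
@[simp] theorem Cell3.ctx_src {x y : P.Obj} (mu : Cell2 P.toPrepolygraph2 x y) (F : Cell3 P x y)
    (nu : Cell2 P.toPrepolygraph2 x y) (h₁ h₂) :
    (Cell3.ctx mu F nu h₁ h₂).src = Cell2.ctx mu F.src nu h₁ h₂ := _root_.id rfl
@[simp] theorem Cell3.ctx_tgt {x y : P.Obj} (mu : Cell2 P.toPrepolygraph2 x y) (F : Cell3 P x y)
    (nu : Cell2 P.toPrepolygraph2 x y) (h₁ h₂) :
    (Cell3.ctx mu F nu h₁ h₂).tgt =
      Cell2.ctx mu F.tgt nu (by simp [h₁]) (by simp [h₂]) := _root_.id rfl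

/-- The 3-cell `μ ∘₁ F`. -/
def Cell3.pre {x y : P.Obj} (mu : Cell2 P.toPrepolygraph2 x y) (F : Cell3 P x y)
    (h : mu.tgt = F.src.src) : Cell3 P x y :=
  Cell3.ctx mu F (Cell2.id F.src.tgt) h (by simp)

/-- The 3-cell `F ∘₁ ν`. -/
def Cell3.post {x y : P.Obj} (F : Cell3 P x y) (nu : Cell2 P.toPrepolygraph2 x y)
    (h : F.src.tgt = nu.src) : Cell3 P x y :=
  Cell3.ctx (Cell2.id F.src.src) F nu (by simp) h

@[simp] theorem Cell3.pre_src {x y : P.Obj} (mu : Cell2 P.toPrepolygraph2 x y) (F : Cell3 P x y)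
    (h) : (Cell3.pre mu F h).src = mu.comp F.src h := by
  apply FreeMor.ext'
  · rfl
  · exact List.append_nil _
@[simp] theorem Cell3.pre_tgt {x y : P.Obj} (mu : Cell2 P.toPrepolygraph2 x y) (F : Cell3 P x y)
    (h) : (Cell3.pre mu F h).tgt = mu.comp F.tgt (by simp [h]) := by
  apply FreeMor.ext'
  · rfl
  · exact List.append_nil _
@[simp] theorem Cell3.post_src {x y : P.Obj} (F : Cell3 P x y) (nu : Cell2 P.toPrepolygraph2 x y)
    (h) : (Cell3.post F nu h).src = F.src.comp nu h := by
  apply FreeMor.ext'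
  · rfl
  · rfl
@[simp] theorem Cell3.post_tgt {x y : P.Obj} (F : Cell3 P x y) (nu : Cell2 P.toPrepolygraph2 x y)
    (h) : (Cell3.post F nu h).tgt = F.tgt.comp nu (by simp [h]) := by
  apply FreeMor.ext'
  · exact F.tgt_src.symm
  · rfl

end Dim3

/-! ## The two sides of an interchange -/

section Sides

variable {P : Prepolygraph3.{u}}

/-- For `φ : f ⇒ f'` and `ψ : h ⇒ h'`, the 2-cell `(φ ∘₀ h) ∘₁ (f' ∘₀ ψ)`. -/
def Cell2.lr {P : Prepolygraph2.{u}} {x y z : P.Obj} (φ : Cell2 P x y) (ψ : Cell2 P y z) :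
    Cell2 P x z :=
  (Cell2.whisk Quiver.Path.nil φ ψ.src).comp (Cell2.whisk φ.tgt ψ Quiver.Path.nil) (by simp)

/-- For `φ : f ⇒ f'` and `ψ : h ⇒ h'`, the 2-cell `(f ∘₀ ψ) ∘₁ (φ ∘₀ h')`. -/
def Cell2.rl {P : Prepolygraph2.{u}} {x y z : P.Obj} (φ : Cell2 P x y) (ψ : Cell2 P y z) :
    Cell2 P x z :=
  (Cell2.whisk φ.src ψ Quiver.Path.nil).comp (Cell2.whisk Quiver.Path.nil φ ψ.tgt) (by simp)

/-- For `F : φ ⇛ φ' : f ⇒ f'` and `ψ : h ⇒ h'`, the 3-cell `(F ∘₀ h) ∘₁ (f' ∘₀ ψ)`. -/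
def Cell3.lrLeft {x y z : P.Obj} (F : Cell3 P x y) (ψ : Cell2 P.toPrepolygraph2 y z) :
    Cell3 P x z :=
  Cell3.post (Cell3.whisk Quiver.Path.nil F ψ.src) (Cell2.whisk F.src.tgt ψ Quiver.Path.nil)
    (by simp)

/-- For `F : φ ⇛ φ' : f ⇒ f'` and `ψ : h ⇒ h'`, the 3-cell `(f ∘₀ ψ) ∘₁ (F ∘₀ h')`. -/
def Cell3.rlLeft {x y z : P.Obj} (F : Cell3 P x y) (ψ : Cell2 P.toPrepolygraph2 y z) :
    Cell3 P x z :=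
  Cell3.pre (Cell2.whisk F.src.src ψ Quiver.Path.nil) (Cell3.whisk Quiver.Path.nil F ψ.tgt)
    (by simp)

/-- For `φ : f ⇒ f'` and `F : ψ ⇛ ψ' : h ⇒ h'`, the 3-cell `(φ ∘₀ h) ∘₁ (f' ∘₀ F)`. -/
def Cell3.lrRight {x y z : P.Obj} (φ : Cell2 P.toPrepolygraph2 x y) (F : Cell3 P y z) :
    Cell3 P x z :=
  Cell3.pre (Cell2.whisk Quiver.Path.nil φ F.src.src) (Cell3.whisk φ.tgt F Quiver.Path.nil)
    (by simp)

/-- For `φ : f ⇒ f'` and `F : ψ ⇛ ψ' : h ⇒ h'`, the 3-cell `(f ∘₀ F) ∘₁ (φ ∘₀ h')`. -/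
def Cell3.rlRight {x y z : P.Obj} (φ : Cell2 P.toPrepolygraph2 x y) (F : Cell3 P y z) :
    Cell3 P x z :=
  Cell3.post (Cell3.whisk φ.src F Quiver.Path.nil) (Cell2.whisk Quiver.Path.nil φ F.src.tgt)
    (by simp)

@[simp] theorem Cell2.lr_src {P : Prepolygraph2.{u}} {x y z : P.Obj} (φ : Cell2 P x y)
    (ψ : Cell2 P y z) : (Cell2.lr φ ψ).src = φ.src.comp ψ.src :=
  Quiver.Path.nil_comp _
@[simp] theorem Cell2.lr_tgt {P : Prepolygraph2.{u}} {x y z : P.Obj} (φ : Cell2 P x y)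
    (ψ : Cell2 P y z) : (Cell2.lr φ ψ).tgt = φ.tgt.comp ψ.tgt := _root_.id rfl
@[simp] theorem Cell2.rl_src {P : Prepolygraph2.{u}} {x y z : P.Obj} (φ : Cell2 P x y)
    (ψ : Cell2 P y z) : (Cell2.rl φ ψ).src = φ.src.comp ψ.src := _root_.id rfl
@[simp] theorem Cell2.rl_tgt {P : Prepolygraph2.{u}} {x y z : P.Obj} (φ : Cell2 P x y)
    (ψ : Cell2 P y z) : (Cell2.rl φ ψ).tgt = φ.tgt.comp ψ.tgt :=
  Quiver.Path.nil_comp _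
@[simp] theorem Cell2.lr_steps {P : Prepolygraph2.{u}} {x y z : P.Obj} (φ : Cell2 P x y)
    (ψ : Cell2 P y z) : (Cell2.lr φ ψ).steps =
      (φ.steps.map fun w => Whisker2.whisk Quiver.Path.nil w ψ.src) ++
        ψ.steps.map fun v => Whisker2.whisk φ.tgt v Quiver.Path.nil := _root_.id rfl
@[simp] theorem Cell2.rl_steps {P : Prepolygraph2.{u}} {x y z : P.Obj} (φ : Cell2 P x y)
    (ψ : Cell2 P y z) : (Cell2.rl φ ψ).steps =
      (ψ.steps.map fun v => Whisker2.whisk φ.src v Quiver.Path.nil) ++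
        φ.steps.map fun w => Whisker2.whisk Quiver.Path.nil w ψ.tgt := _root_.id rfl

theorem Cell3.lrLeft_src {x y z : P.Obj} (F : Cell3 P x y) (ψ : Cell2 P.toPrepolygraph2 y z) :
    (F.lrLeft ψ).src = Cell2.lr F.src ψ := Cell3.post_src _ _ _
theorem Cell3.lrLeft_tgt {x y z : P.Obj} (F : Cell3 P x y) (ψ : Cell2 P.toPrepolygraph2 y z) :
    (F.lrLeft ψ).tgt = Cell2.lr F.tgt ψ := by
  refine (Cell3.post_tgt _ _ _).trans (FreeMor.ext' ?_ ?_) <;> simp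
theorem Cell3.rlLeft_src {x y z : P.Obj} (F : Cell3 P x y) (ψ : Cell2 P.toPrepolygraph2 y z) :
    (F.rlLeft ψ).src = Cell2.rl F.src ψ := Cell3.pre_src _ _ _
theorem Cell3.rlLeft_tgt {x y z : P.Obj} (F : Cell3 P x y) (ψ : Cell2 P.toPrepolygraph2 y z) :
    (F.rlLeft ψ).tgt = Cell2.rl F.tgt ψ := by
  refine (Cell3.pre_tgt _ _ _).trans (FreeMor.ext' ?_ ?_) <;> simp
theorem Cell3.lrRight_src {x y z : P.Obj} (φ : Cell2 P.toPrepolygraph2 x y) (F : Cell3 P y z) :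
    (Cell3.lrRight φ F).src = Cell2.lr φ F.src := Cell3.pre_src _ _ _
theorem Cell3.lrRight_tgt {x y z : P.Obj} (φ : Cell2 P.toPrepolygraph2 x y) (F : Cell3 P y z) :
    (Cell3.lrRight φ F).tgt = Cell2.lr φ F.tgt := by
  refine (Cell3.pre_tgt _ _ _).trans (FreeMor.ext' ?_ ?_) <;> simp
theorem Cell3.rlRight_src {x y z : P.Obj} (φ : Cell2 P.toPrepolygraph2 x y) (F : Cell3 P y z) :
    (Cell3.rlRight φ F).src = Cell2.rl φ F.src := Cell3.post_src _ _ _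
theorem Cell3.rlRight_tgt {x y z : P.Obj} (φ : Cell2 P.toPrepolygraph2 x y) (F : Cell3 P y z) :
    (Cell3.rlRight φ F).tgt = Cell2.rl φ F.tgt := by
  refine (Cell3.post_tgt _ _ _).trans (FreeMor.ext' ?_ ?_) <;> simp

end Sides

/-! ## Interchange 3-cells -/

/-- A family of interchange generators
`X_{α,g,β} : (α ∘₀ g ∘₀ h) ∘₁ (f' ∘₀ g ∘₀ β) ⇛ (f ∘₀ g ∘₀ β) ∘₁ (α ∘₀ g ∘₀ h')`,
for all 0-composable 2-generators `α : f ⇒ f'`, 1-cells `g` and 2-generators `β : h ⇒ h'`. -/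
structure Interchanger (P : Prepolygraph3.{u}) where
  gen : ∀ {x x' y' y : P.Obj}, P.Gen2 x x' → Cell1 P.toPrepolygraph1 x' y' → P.Gen2 y' y →
    P.Gen3 x y
  src_gen : ∀ {x x' y' y : P.Obj} (α : P.Gen2 x x') (g : Cell1 P.toPrepolygraph1 x' y')
    (β : P.Gen2 y' y), P.src3 (gen α g β) =
      Cell2.lr (Cell2.ofGen α) (Cell2.whisk g (Cell2.ofGen β) Quiver.Path.nil)
  tgt_gen : ∀ {x x' y' y : P.Obj} (α : P.Gen2 x x') (g : Cell1 P.toPrepolygraph1 x' y')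
    (β : P.Gen2 y' y), P.tgt3 (gen α g β) =
      Cell2.rl (Cell2.ofGen α) (Cell2.whisk g (Cell2.ofGen β) Quiver.Path.nil)

namespace Interchanger

variable {P : Prepolygraph3.{u}} (X : Interchanger P) {x y z : P.Obj}

/-- For whiskers `w = l ∘₀ α ∘₀ r` and `v = l' ∘₀ β ∘₀ r'`, the 3-cell
`X_{w,v} = l ∘₀ X_{α, r ∘₀ l', β} ∘₀ r'`. -/
def whiskerCell (w : Whisker2 P.toPrepolygraph2 x y) (v : Whisker2 P.toPrepolygraph2 y z) :
    Cell3 P x z :=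
  Cell3.whisk w.l (Cell3.ofGen (X.gen w.gen (w.r.comp v.l) v.gen)) v.r

theorem whiskerCell_src (w : Whisker2 P.toPrepolygraph2 x y)
    (v : Whisker2 P.toPrepolygraph2 y z) :
    (X.whiskerCell w v).src = Cell2.lr w.toCell v.toCell := by
  apply FreeMor.ext' <;>
    simp [whiskerCell, X.src_gen, Whisker2.src, Whisker2.tgt, Whisker2.whisk, Whisker2.toCell,
      Cell2.ofGen]

theorem whiskerCell_tgt (w : Whisker2 P.toPrepolygraph2 x y)
    (v : Whisker2 P.toPrepolygraph2 y z) :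
    (X.whiskerCell w v).tgt = Cell2.rl w.toCell v.toCell := by
  apply FreeMor.ext' <;>
    simp [whiskerCell, X.tgt_gen, Whisker2.src, Whisker2.tgt, Whisker2.whisk, Whisker2.toCell,
      Cell2.ofGen]

/-- The 3-cell `X_{w,ψ}` for a whisker `w` and a 2-cell `ψ = v₁ ∘₁ ⋯ ∘₁ vₙ`, which moves `w`
successively past `v₁, …, vₙ`:
`X_{w, v ∘₁ ψ'} = (X_{w,v} ∘₁ (∂⁺w ∘₀ ψ')) ∘₂ ((∂⁻w ∘₀ v) ∘₁ X_{w,ψ'})`. -/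
def rowAux (w : Whisker2 P.toPrepolygraph2 x y) : (vs : List (Whisker2 P.toPrepolygraph2 y z)) →
    (g g' : Cell1 P.toPrepolygraph1 y z) → (h : IsPathFrom Whisker2.src Whisker2.tgt g vs g') →
    {F : Cell3 P x z // F.src = Cell2.lr w.toCell ⟨g, g', vs, h⟩ ∧
      F.tgt = Cell2.rl w.toCell ⟨g, g', vs, h⟩}
  | [], g, g', h => ⟨Cell3.id (Cell2.whisk Quiver.Path.nil w.toCell g), by
      cases h
      constructor <;> apply FreeMor.ext' <;> simp⟩
  | v :: vs, g, g', h =>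
    let ψ' : Cell2 P.toPrepolygraph2 y z := ⟨v.tgt, g', vs, h.2⟩
    let F := rowAux w vs v.tgt g' h.2
    ⟨(Cell3.post (X.whiskerCell w v) (Cell2.whisk w.tgt ψ' Quiver.Path.nil)
        (by simp [whiskerCell_src, ψ'])).comp
      (Cell3.pre (Cell2.whisk w.src v.toCell Quiver.Path.nil) F.1 (by simp [F.2.1]))
      (by
        rw [Cell3.post_tgt, Cell3.pre_src]
        apply FreeMor.ext' <;> simp [F.2.1, whiskerCell_tgt, ψ']), by
      obtain ⟨rfl, h⟩ := h
      constructor <;> apply FreeMor.ext' <;>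
        simp [F.2.2, whiskerCell_src, ψ', Whisker2.toCell]⟩

/-- The 3-cell `X_{φ,ψ}` for a 2-cell `φ = w₁ ∘₁ ⋯ ∘₁ wₘ`, which moves `wₘ, …, w₁`, in this order,
past `ψ`: `X_{w ∘₁ φ', ψ} = ((w ∘₀ ∂⁻ψ) ∘₁ X_{φ',ψ}) ∘₂ (X_{w,ψ} ∘₁ (φ' ∘₀ ∂⁺ψ))`. -/
def cellAux (ψ : Cell2 P.toPrepolygraph2 y z) : (ws : List (Whisker2 P.toPrepolygraph2 x y)) →
    (f f' : Cell1 P.toPrepolygraph1 x y) → (h : IsPathFrom Whisker2.src Whisker2.tgt f ws f') →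
    {F : Cell3 P x z // F.src = Cell2.lr ⟨f, f', ws, h⟩ ψ ∧ F.tgt = Cell2.rl ⟨f, f', ws, h⟩ ψ}
  | [], f, f', h => ⟨Cell3.id (Cell2.whisk f ψ Quiver.Path.nil), by
      cases h
      constructor <;> apply FreeMor.ext' <;> simp⟩
  | w :: ws, f, f', h =>
    let φ' : Cell2 P.toPrepolygraph2 x y := ⟨w.tgt, f', ws, h.2⟩
    let F := cellAux ψ ws w.tgt f' h.2
    let G := X.rowAux w ψ.steps ψ.src ψ.tgt ψ.isPath
    ⟨(Cell3.pre (Cell2.whisk Quiver.Path.nil w.toCell ψ.src) F.1 (by simp [F.2.1])).comp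
      (Cell3.post G.1 (Cell2.whisk Quiver.Path.nil φ' ψ.tgt) (by simp [G.2.1, φ']))
      (by
        rw [Cell3.pre_tgt, Cell3.post_src]
        apply FreeMor.ext' <;> simp [F.2.2, G.2.1, φ', Whisker2.toCell]), by
      obtain ⟨rfl, h⟩ := h
      constructor <;> apply FreeMor.ext' <;>
        simp [F.2.1, G.2.2, φ', Whisker2.toCell]⟩

/-- The interchange 3-cell
`X_{φ,ψ} : (φ ∘₀ h) ∘₁ (f' ∘₀ ψ) ⇛ (f ∘₀ ψ) ∘₁ (φ ∘₀ h')` for 0-composable 2-cells `φ : f ⇒ f'` and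
`ψ : h ⇒ h'`. -/
def cell (φ : Cell2 P.toPrepolygraph2 x y) (ψ : Cell2 P.toPrepolygraph2 y z) : Cell3 P x z :=
  (X.cellAux ψ φ.steps φ.src φ.tgt φ.isPath).1

theorem cell_src (φ : Cell2 P.toPrepolygraph2 x y) (ψ : Cell2 P.toPrepolygraph2 y z) :
    (X.cell φ ψ).src = Cell2.lr φ ψ := (X.cellAux ψ φ.steps φ.src φ.tgt φ.isPath).2.1

theorem cell_tgt (φ : Cell2 P.toPrepolygraph2 x y) (ψ : Cell2 P.toPrepolygraph2 y z) :
    (X.cell φ ψ).tgt = Cell2.rl φ ψ := (X.cellAux ψ φ.steps φ.src φ.tgt φ.isPath).2.2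

/-- For `φ = φ₀ ∘₁ w : f ⇒ f'` and `ψ = v ∘₁ ψ₀ : h ⇒ h'` with `w` and `v` whiskers, the first move
`(φ₀ ∘₀ h) ∘₁ X_{w,v} ∘₁ (f' ∘₀ ψ₀)` from `(φ ∘₀ h) ∘₁ (f' ∘₀ ψ)`: it exchanges the last whisker of
`φ` with the first whisker of `ψ`. -/
def firstMove (φ₀ : Cell2 P.toPrepolygraph2 x y) (w : Whisker2 P.toPrepolygraph2 x y)
    (v : Whisker2 P.toPrepolygraph2 y z) (ψ₀ : Cell2 P.toPrepolygraph2 y z)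
    (h₁ : φ₀.tgt = w.src) (h₂ : v.tgt = ψ₀.src) : Cell3 P x z :=
  Cell3.ctx (Cell2.whisk Quiver.Path.nil φ₀ v.src) (X.whiskerCell w v)
    (Cell2.whisk w.tgt ψ₀ Quiver.Path.nil)
    (by simp [whiskerCell_src, h₁]) (by simp [whiskerCell_src, h₂])

end Interchanger

/-! ## Gray presentations -/

/-- A 4-prepolygraph: the 4-generators go between parallel 3-cells. -/
structure Prepolygraph4 extends Prepolygraph3.{u} where
  Gen4 : Obj → Obj → Type u
  src4 : ∀ {x y : Obj}, Gen4 x y → Cell3 toPrepolygraph3 x y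
  tgt4 : ∀ {x y : Obj}, Gen4 x y → Cell3 toPrepolygraph3 x y
  src_src4 : ∀ {x y : Obj} (G : Gen4 x y), (tgt4 G).src = (src4 G).src
  tgt_src4 : ∀ {x y : Obj} (G : Gen4 x y), (tgt4 G).tgt = (src4 G).tgt

section Independence

variable {P : Prepolygraph3.{u}} {w x y x' y' z : P.Obj}

/-- The 3-cell `(l₁ ∘₀ A ∘₀ r₁) ∘₁ χ ∘₁ (l₂ ∘₀ φ₂ ∘₀ r₂)`. -/
def Cell3.actTop (l₁ : Cell1 P.toPrepolygraph1 w x) (A : P.Gen3 x y)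
    (r₁ : Cell1 P.toPrepolygraph1 y z) (χ : Cell2 P.toPrepolygraph2 w z)
    (l₂ : Cell1 P.toPrepolygraph1 w x') (φ₂ : Cell2 P.toPrepolygraph2 x' y')
    (r₂ : Cell1 P.toPrepolygraph1 y' z) (h₁ : l₁.comp ((P.src3 A).tgt.comp r₁) = χ.src)
    (h₂ : χ.tgt = l₂.comp (φ₂.src.comp r₂)) : Cell3 P w z :=
  Cell3.post (Cell3.whisk l₁ (Cell3.ofGen A) r₁) (χ.comp (Cell2.whisk l₂ φ₂ r₂) (by simp [h₂]))
    (by simp [h₁])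

/-- The 3-cell `(l₁ ∘₀ φ₁ ∘₀ r₁) ∘₁ χ ∘₁ (l₂ ∘₀ A ∘₀ r₂)`. -/
def Cell3.actBot (l₁ : Cell1 P.toPrepolygraph1 w x) (φ₁ : Cell2 P.toPrepolygraph2 x y)
    (r₁ : Cell1 P.toPrepolygraph1 y z) (χ : Cell2 P.toPrepolygraph2 w z)
    (l₂ : Cell1 P.toPrepolygraph1 w x') (A : P.Gen3 x' y')
    (r₂ : Cell1 P.toPrepolygraph1 y' z) (h₁ : l₁.comp (φ₁.tgt.comp r₁) = χ.src)
    (h₂ : χ.tgt = l₂.comp ((P.src3 A).src.comp r₂)) : Cell3 P w z :=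
  Cell3.pre ((Cell2.whisk l₁ φ₁ r₁).comp χ (by simp [h₁])) (Cell3.whisk l₂ (Cell3.ofGen A) r₂)
    (by simp [h₂])

variable (l₁ : Cell1 P.toPrepolygraph1 w x) (A₁ : P.Gen3 x y)
  (r₁ : Cell1 P.toPrepolygraph1 y z) (χ : Cell2 P.toPrepolygraph2 w z)
  (l₂ : Cell1 P.toPrepolygraph1 w x') (A₂ : P.Gen3 x' y')
  (r₂ : Cell1 P.toPrepolygraph1 y' z) (h₁ : l₁.comp ((P.src3 A₁).tgt.comp r₁) = χ.src)
  (h₂ : χ.tgt = l₂.comp ((P.src3 A₂).src.comp r₂))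

/-- The 3-cell `((l₁ ∘₀ A₁ ∘₀ r₁) ∘₁ χ ∘₁ (l₂ ∘₀ φ₂ ∘₀ r₂)) ∘₂
((l₁ ∘₀ φ₁' ∘₀ r₁) ∘₁ χ ∘₁ (l₂ ∘₀ A₂ ∘₀ r₂))`, where `Aᵢ : φᵢ ⇛ φᵢ'`. -/
def Cell3.indepSrc : Cell3 P w z :=
  (Cell3.actTop l₁ A₁ r₁ χ l₂ (P.src3 A₂) r₂ h₁ h₂).comp
    (Cell3.actBot l₁ (P.tgt3 A₁) r₁ χ l₂ A₂ r₂ (by simp [h₁]) h₂)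
    (by
      rw [Cell3.actTop, Cell3.actBot, Cell3.post_tgt, Cell3.pre_src]
      apply FreeMor.ext' <;> simp)

/-- The 3-cell `((l₁ ∘₀ φ₁ ∘₀ r₁) ∘₁ χ ∘₁ (l₂ ∘₀ A₂ ∘₀ r₂)) ∘₂
((l₁ ∘₀ A₁ ∘₀ r₁) ∘₁ χ ∘₁ (l₂ ∘₀ φ₂' ∘₀ r₂))`, where `Aᵢ : φᵢ ⇛ φᵢ'`. -/
def Cell3.indepTgt : Cell3 P w z :=
  (Cell3.actBot l₁ (P.src3 A₁) r₁ χ l₂ A₂ r₂ h₁ h₂).comp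
    (Cell3.actTop l₁ A₁ r₁ χ l₂ (P.tgt3 A₂) r₂ h₁ (by simp [h₂]))
    (by
      rw [Cell3.actTop, Cell3.actBot, Cell3.post_src, Cell3.pre_tgt]
      apply FreeMor.ext' <;> simp)

end Independence

/-- For all 3-generators `A₁ : φ₁ ⇛ φ₁'` and `A₂ : φ₂ ⇛ φ₂'` in a 1-composable configuration, there is
an independence generator. -/
def Prepolygraph4.HasIndependence (Q : Prepolygraph4.{u}) : Prop :=
  ∀ {w x y x' y' z : Q.Obj} (l₁ : Cell1 Q.toPrepolygraph1 w x) (A₁ : Q.Gen3 x y)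
    (r₁ : Cell1 Q.toPrepolygraph1 y z) (χ : Cell2 Q.toPrepolygraph2 w z)
    (l₂ : Cell1 Q.toPrepolygraph1 w x') (A₂ : Q.Gen3 x' y') (r₂ : Cell1 Q.toPrepolygraph1 y' z)
    (h₁ : l₁.comp ((Q.src3 A₁).tgt.comp r₁) = χ.src)
    (h₂ : χ.tgt = l₂.comp ((Q.src3 A₂).src.comp r₂)),
    ∃ G : Q.Gen4 w z, Q.src4 G = Cell3.indepSrc l₁ A₁ r₁ χ l₂ A₂ r₂ h₁ h₂ ∧
      Q.tgt4 G = Cell3.indepTgt l₁ A₁ r₁ χ l₂ A₂ r₂ h₁ h₂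

/-- For all `A : φ ⇛ φ' : f ⇒ f'`, 1-cells `g` and `β : h ⇒ h'`, there is a 4-generator from
`((A ∘₀ g ∘₀ h) ∘₁ (f' ∘₀ g ∘₀ β)) ∘₂ X_{φ', g ∘₀ β}` to
`X_{φ, g ∘₀ β} ∘₂ ((f ∘₀ g ∘₀ β) ∘₁ (A ∘₀ g ∘₀ h'))`. -/
def Prepolygraph4.HasNaturalityLeft (Q : Prepolygraph4.{u})
    (X : Interchanger Q.toPrepolygraph3) : Prop :=
  ∀ {x x' y' y : Q.Obj} (A : Q.Gen3 x x') (g : Cell1 Q.toPrepolygraph1 x' y') (β : Q.Gen2 y' y),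
    ∃ G : Q.Gen4 x y,
      Q.src4 G = ((Cell3.ofGen A).lrLeft (Cell2.whisk g (Cell2.ofGen β) Quiver.Path.nil)).comp
        (X.cell (Q.tgt3 A) (Cell2.whisk g (Cell2.ofGen β) Quiver.Path.nil))
        (by rw [Cell3.lrLeft_tgt, X.cell_src, Cell3.ofGen_tgt]) ∧
      Q.tgt4 G = (X.cell (Q.src3 A) (Cell2.whisk g (Cell2.ofGen β) Quiver.Path.nil)).comp
        ((Cell3.ofGen A).rlLeft (Cell2.whisk g (Cell2.ofGen β) Quiver.Path.nil))
        (by rw [Cell3.rlLeft_src, X.cell_tgt, Cell3.ofGen_src])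

/-- For all `α : f ⇒ f'`, 1-cells `g` and `B : ψ ⇛ ψ' : h ⇒ h'`, there is a 4-generator from
`((α ∘₀ g ∘₀ h) ∘₁ (f' ∘₀ g ∘₀ B)) ∘₂ X_{α ∘₀ g, ψ'}` to
`X_{α ∘₀ g, ψ} ∘₂ ((f ∘₀ g ∘₀ B) ∘₁ (α ∘₀ g ∘₀ h'))`. -/
def Prepolygraph4.HasNaturalityRight (Q : Prepolygraph4.{u})
    (X : Interchanger Q.toPrepolygraph3) : Prop :=
  ∀ {x x' y' y : Q.Obj} (α : Q.Gen2 x x') (g : Cell1 Q.toPrepolygraph1 x' y') (B : Q.Gen3 y' y),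
    ∃ G : Q.Gen4 x y,
      Q.src4 G =
        (Cell3.lrRight (Cell2.whisk Quiver.Path.nil (Cell2.ofGen α) g) (Cell3.ofGen B)).comp
          (X.cell (Cell2.whisk Quiver.Path.nil (Cell2.ofGen α) g) (Q.tgt3 B))
          (by rw [Cell3.lrRight_tgt, X.cell_src, Cell3.ofGen_tgt]) ∧
      Q.tgt4 G = (X.cell (Cell2.whisk Quiver.Path.nil (Cell2.ofGen α) g) (Q.src3 B)).comp
        (Cell3.rlRight (Cell2.whisk Quiver.Path.nil (Cell2.ofGen α) g) (Cell3.ofGen B))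
        (by rw [Cell3.rlRight_src, X.cell_tgt, Cell3.ofGen_src])

/-- A Gray presentation: a 4-prepolygraph with interchange generators (in dimension 3), and with
independence generators and interchange naturality generators (in dimension 4). It may have other
3-generators and 4-generators. -/
structure GrayPresentation extends Prepolygraph4.{u} where
  X : Interchanger toPrepolygraph3
  hasIndependence : toPrepolygraph4.HasIndependence
  hasNaturalityLeft : toPrepolygraph4.HasNaturalityLeft X
  hasNaturalityRight : toPrepolygraph4.HasNaturalityRight X

/-! ## Rewriting systems -/

/-- `R` is a congruence on the 3-cells of the free precategory on `P`: an equivalence relation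
between parallel 3-cells compatible with `∘₀`, `∘₁` and `∘₂`. -/
structure IsCongruence (P : Prepolygraph3.{u})
    (R : ∀ {x y : P.Obj}, Cell3 P x y → Cell3 P x y → Prop) : Prop where
  src_eq : ∀ {x y : P.Obj} {F G : Cell3 P x y}, R F G → F.src = G.src
  tgt_eq : ∀ {x y : P.Obj} {F G : Cell3 P x y}, R F G → F.tgt = G.tgt
  refl : ∀ {x y : P.Obj} (F : Cell3 P x y), R F F
  symm : ∀ {x y : P.Obj} {F G : Cell3 P x y}, R F G → R G F
  trans : ∀ {x y : P.Obj} {F G H : Cell3 P x y}, R F G → R G H → R F H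
  whisk : ∀ {x' x y y' : P.Obj} {F G : Cell3 P x y} (u : Cell1 P.toPrepolygraph1 x' x)
    (v : Cell1 P.toPrepolygraph1 y y'), R F G → R (Cell3.whisk u F v) (Cell3.whisk u G v)
  ctx : ∀ {x y : P.Obj} {F G : Cell3 P x y} (mu nu : Cell2 P.toPrepolygraph2 x y)
    (h₁ : mu.tgt = F.src.src) (h₂ : F.src.tgt = nu.src) (h₁' : mu.tgt = G.src.src)
    (h₂' : G.src.tgt = nu.src), R F G → R (Cell3.ctx mu F nu h₁ h₂) (Cell3.ctx mu G nu h₁' h₂')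
  comp : ∀ {x y : P.Obj} {F F' G G' : Cell3 P x y} (h : F.tgt = G.src) (h' : F'.tgt = G'.src),
    R F F' → R G G' → R (F.comp G h) (F'.comp G' h')

/-- A rewriting system on `P`: a congruence on the 3-cells of the free precategory on `P`. -/
structure RewritingSystem (P : Prepolygraph3.{u}) where
  rel : ∀ {x y : P.Obj}, Cell3 P x y → Cell3 P x y → Prop
  isCongruence : IsCongruence P rel

/-- The smallest congruence that relates the 3-source and the 3-target of every 4-generator. -/
inductive Prepolygraph4.StdCong (Q : Prepolygraph4.{u}) :
    ∀ {x y : Q.Obj}, Cell3 Q.toPrepolygraph3 x y → Cell3 Q.toPrepolygraph3 x y → Prop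
  | gen {x y : Q.Obj} (G : Q.Gen4 x y) : StdCong Q (Q.src4 G) (Q.tgt4 G)
  | refl {x y : Q.Obj} (F : Cell3 Q.toPrepolygraph3 x y) : StdCong Q F F
  | symm {x y : Q.Obj} {F G : Cell3 Q.toPrepolygraph3 x y} : StdCong Q F G → StdCong Q G F
  | trans {x y : Q.Obj} {F G H : Cell3 Q.toPrepolygraph3 x y} :
      StdCong Q F G → StdCong Q G H → StdCong Q F H
  | whisk {x' x y y' : Q.Obj} {F G : Cell3 Q.toPrepolygraph3 x y}
      (u : Cell1 Q.toPrepolygraph1 x' x) (v : Cell1 Q.toPrepolygraph1 y y') :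
      StdCong Q F G → StdCong Q (Cell3.whisk u F v) (Cell3.whisk u G v)
  | ctx {x y : Q.Obj} {F G : Cell3 Q.toPrepolygraph3 x y}
      (mu nu : Cell2 Q.toPrepolygraph2 x y) (h₁ : mu.tgt = F.src.src) (h₂ : F.src.tgt = nu.src)
      (h₁' : mu.tgt = G.src.src) (h₂' : G.src.tgt = nu.src) :
      StdCong Q F G → StdCong Q (Cell3.ctx mu F nu h₁ h₂) (Cell3.ctx mu G nu h₁' h₂')
  | comp {x y : Q.Obj} {F F' G G' : Cell3 Q.toPrepolygraph3 x y} (h : F.tgt = G.src)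
      (h' : F'.tgt = G'.src) :
      StdCong Q F F' → StdCong Q G G' → StdCong Q (F.comp G h) (F'.comp G' h')

theorem Prepolygraph4.StdCong.parallel {Q : Prepolygraph4.{u}} {x y : Q.Obj}
    {F G : Cell3 Q.toPrepolygraph3 x y} (h : Q.StdCong F G) : F.src = G.src ∧ F.tgt = G.tgt := by
  induction h with
  | gen G => exact ⟨(Q.src_src4 G).symm, (Q.tgt_src4 G).symm⟩
  | refl F => exact ⟨rfl, rfl⟩
  | symm _ ih => exact ⟨ih.1.symm, ih.2.symm⟩
  | trans _ _ ih ih' => exact ⟨ih.1.trans ih'.1, ih.2.trans ih'.2⟩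
  | whisk u v _ ih => exact ⟨by simp [ih.1], by simp [ih.2]⟩
  | ctx mu nu h₁ h₂ h₁' h₂' _ ih =>
    constructor <;> apply FreeMor.ext' <;> simp [ih.1, ih.2]
  | comp h h' _ _ ih ih' => exact ⟨ih.1, ih'.2⟩

/-- The rewriting system of a 4-prepolygraph. -/
def Prepolygraph4.rewritingSystem (Q : Prepolygraph4.{u}) :
    RewritingSystem Q.toPrepolygraph3 where
  rel := Q.StdCong
  isCongruence :=
    { src_eq := fun h => h.parallel.1
      tgt_eq := fun h => h.parallel.2
      refl := .refl
      symm := .symm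
      trans := .trans
      whisk := .whisk
      ctx := .ctx
      comp := .comp }

section Branchings

variable {P : Prepolygraph3.{u}}

/-- A rewriting step is a 3-cell of the form `λ ∘₁ (l ∘₀ A ∘₀ r) ∘₁ ρ` for a 3-generator `A`. -/
def Cell3.IsStep {x y : P.Obj} (S : Cell3 P x y) : Prop :=
  ∃ (a b : P.Obj) (l : Cell1 P.toPrepolygraph1 x a) (A : P.Gen3 a b)
    (r : Cell1 P.toPrepolygraph1 b y) (lam rho : Cell2 P.toPrepolygraph2 x y)
    (h₁ : lam.tgt = l.comp ((P.src3 A).src.comp r))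
    (h₂ : l.comp ((P.src3 A).tgt.comp r) = rho.src),
    S = Cell3.ctx lam (Cell3.whisk l (Cell3.ofGen A) r) rho (by simp [h₁]) (by simp [← h₂])

/-- A local branching: a pair of rewriting steps with the same source. -/
structure IsLocalBranching {x y : P.Obj} (S₁ S₂ : Cell3 P x y) : Prop where
  step₁ : S₁.IsStep
  step₂ : S₂.IsStep
  src_eq : S₁.src = S₂.src

/-- The branching `(F₁, F₂)` is confluent: `F₁ ∘₂ G₁ ≡ F₂ ∘₂ G₂` for some rewriting paths `G₁` and
`G₂` with the same target. -/
def RewritingSystem.IsConfluentBranching (R : RewritingSystem P) {x y : P.Obj}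
    (F₁ F₂ : Cell3 P x y) : Prop :=
  ∃ (G₁ G₂ : Cell3 P x y) (h₁ : F₁.tgt = G₁.src) (h₂ : F₂.tgt = G₂.src),
    G₁.tgt = G₂.tgt ∧ R.rel (F₁.comp G₁ h₁) (F₂.comp G₂ h₂)

/-- Every local branching is confluent. -/
def RewritingSystem.IsLocallyConfluent (R : RewritingSystem P) : Prop :=
  ∀ {x y : P.Obj} (S₁ S₂ : Cell3 P x y), IsLocalBranching S₁ S₂ → R.IsConfluentBranching S₁ S₂

/-- The local branching `(S₁, S₂)` is minimal: it is not obtained from another local branching by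
putting both components in the same context. -/
def IsMinimal {x y : P.Obj} (S₁ S₂ : Cell3 P x y) : Prop :=
  ∀ {a b : P.Obj} (T₁ T₂ : Cell3 P a b), IsLocalBranching T₁ T₂ →
    ∀ (l : Cell1 P.toPrepolygraph1 x a) (r : Cell1 P.toPrepolygraph1 b y)
      (lam rho : Cell2 P.toPrepolygraph2 x y)
      (h₁ : lam.tgt = (Cell3.whisk l T₁ r).src.src) (h₂ : (Cell3.whisk l T₁ r).src.tgt = rho.src)
      (h₁' : lam.tgt = (Cell3.whisk l T₂ r).src.src)
      (h₂' : (Cell3.whisk l T₂ r).src.tgt = rho.src),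
      S₁ = Cell3.ctx lam (Cell3.whisk l T₁ r) rho h₁ h₂ →
      S₂ = Cell3.ctx lam (Cell3.whisk l T₂ r) rho h₁' h₂' →
      Cell1.IsId l ∧ Cell1.IsId r ∧ lam = Cell2.id lam.src ∧ rho = Cell2.id rho.src

/-- The branching `(S₁, S₂)` is independent: `S₁ = (l₁ ∘₀ A₁ ∘₀ r₁) ∘₁ χ ∘₁ (l₂ ∘₀ φ₂ ∘₀ r₂)` and
`S₂ = (l₁ ∘₀ φ₁ ∘₀ r₁) ∘₁ χ ∘₁ (l₂ ∘₀ A₂ ∘₀ r₂)` for 3-generators `Aᵢ : φᵢ ⇛ φᵢ'`. -/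
def IsIndependent {w z : P.Obj} (S₁ S₂ : Cell3 P w z) : Prop :=
  ∃ (x y x' y' : P.Obj) (l₁ : Cell1 P.toPrepolygraph1 w x) (A₁ : P.Gen3 x y)
    (r₁ : Cell1 P.toPrepolygraph1 y z) (χ : Cell2 P.toPrepolygraph2 w z)
    (l₂ : Cell1 P.toPrepolygraph1 w x') (A₂ : P.Gen3 x' y') (r₂ : Cell1 P.toPrepolygraph1 y' z)
    (h₁ : l₁.comp ((P.src3 A₁).tgt.comp r₁) = χ.src)
    (h₂ : χ.tgt = l₂.comp ((P.src3 A₂).src.comp r₂)),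
    S₁ = Cell3.actTop l₁ A₁ r₁ χ l₂ (P.src3 A₂) r₂ h₁ h₂ ∧
      S₂ = Cell3.actBot l₁ (P.src3 A₁) r₁ χ l₂ A₂ r₂ h₁ h₂

end Branchings

namespace GrayPresentation

variable (Q : GrayPresentation.{u}) {x z : Q.Obj}

/-- For a 3-generator `A : φ ⇛ φ' : f ⇒ f'`, a 1-cell `g` and a 2-cell `ψ : h ⇒ h'`,
`S₁ = (A ∘₀ g ∘₀ h) ∘₁ (f' ∘₀ g ∘₀ ψ)` and `S₂` exchanges the last whisker of `φ` with the first
whisker of `g ∘₀ ψ`. -/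
def IsNaturalLeft (S₁ S₂ : Cell3 Q.toPrepolygraph3 x z) : Prop :=
  ∃ (x' y' : Q.Obj) (A : Q.Gen3 x x') (g : Cell1 Q.toPrepolygraph1 x' y')
    (ψ : Cell2 Q.toPrepolygraph2 y' z)
    (φ₀ : Cell2 Q.toPrepolygraph2 x x') (w : Whisker2 Q.toPrepolygraph2 x x')
    (v : Whisker2 Q.toPrepolygraph2 x' z) (ψ₀ : Cell2 Q.toPrepolygraph2 x' z)
    (h₁ : φ₀.tgt = w.src) (h₂ : v.tgt = ψ₀.src),
    Q.src3 A = φ₀.comp w.toCell (by simp [h₁]) ∧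
    Cell2.whisk g ψ Quiver.Path.nil = v.toCell.comp ψ₀ (by simp [h₂]) ∧
    S₁ = (Cell3.ofGen A).lrLeft (Cell2.whisk g ψ Quiver.Path.nil) ∧
    S₂ = Q.X.firstMove φ₀ w v ψ₀ h₁ h₂

/-- For a 2-cell `φ : f ⇒ f'`, a 1-cell `g` and a 3-generator `B : ψ ⇛ ψ' : h ⇒ h'`,
`S₁ = (φ ∘₀ g ∘₀ h) ∘₁ (f' ∘₀ g ∘₀ B)` and `S₂` exchanges the last whisker of `φ ∘₀ g` with the
first whisker of `ψ`. -/
def IsNaturalRight (S₁ S₂ : Cell3 Q.toPrepolygraph3 x z) : Prop :=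
  ∃ (x' y' : Q.Obj) (φ : Cell2 Q.toPrepolygraph2 x x') (g : Cell1 Q.toPrepolygraph1 x' y')
    (B : Q.Gen3 y' z)
    (φ₀ : Cell2 Q.toPrepolygraph2 x y') (w : Whisker2 Q.toPrepolygraph2 x y')
    (v : Whisker2 Q.toPrepolygraph2 y' z) (ψ₀ : Cell2 Q.toPrepolygraph2 y' z)
    (h₁ : φ₀.tgt = w.src) (h₂ : v.tgt = ψ₀.src),
    Cell2.whisk Quiver.Path.nil φ g = φ₀.comp w.toCell (by simp [h₁]) ∧
    Q.src3 B = v.toCell.comp ψ₀ (by simp [h₂]) ∧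
    S₁ = Cell3.lrRight (Cell2.whisk Quiver.Path.nil φ g) (Cell3.ofGen B) ∧
    S₂ = Q.X.firstMove φ₀ w v ψ₀ h₁ h₂

/-- The branching `(S₁, S₂)` is natural. -/
def IsNatural (S₁ S₂ : Cell3 Q.toPrepolygraph3 x z) : Prop :=
  Q.IsNaturalLeft S₁ S₂ ∨ Q.IsNaturalRight S₁ S₂

/-- The pair `(S₁, S₂)` is a critical branching: a minimal local branching such that neither it nor
its symmetric branching is trivial, independent or natural. -/
structure IsCritical (S₁ S₂ : Cell3 Q.toPrepolygraph3 x z) : Prop where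
  isLocalBranching : IsLocalBranching S₁ S₂
  isMinimal : IsMinimal S₁ S₂
  not_trivial : S₁ ≠ S₂
  not_independent : ¬ IsIndependent S₁ S₂
  not_independent_symm : ¬ IsIndependent S₂ S₁
  not_natural : ¬ Q.IsNatural S₁ S₂
  not_natural_symm : ¬ Q.IsNatural S₂ S₁

end GrayPresentation

end GrayRewriting

/-! Local confluence trivially gives confluence of critical branchings. For the converse, confluence
of a branching survives every context, because `≡` is a congruence and contexts distribute over
`∘₂`. A context that is not an identity strictly enlarges the source, so every local branching sits
in a context around a minimal one (`IsLocalBranching.induction`). A minimal branching that is not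
critical is, up to symmetry, trivial, independent or natural, and each of these classes is
confluent.

Independent branchings are closed by the independence generators themselves. For a natural
branching, `S₂` is the first move of `X_{φ,ψ}` (`exists_firstMove_comp`). With `S₁` given by `A : φ
⇛ φ'`, naturality says `S₁ ∘₂ X_{φ',ψ} ≡ X_{φ,ψ} ∘₂ A`, where `A` is whiskered suitably on the
right-hand side. Since that side starts with `S₂`, it closes the branching. The other form is dual.

What has to be proved is therefore naturality of `X` against arbitrary 2-cells, the 4-generators
giving it only against one generator and a 1-cell. On the right (`naturality_right`) this is an
induction along the recursion that defines `X`. On the left (`naturality_left`) the second argument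
must be split, and this splitting holds only up to `≡`. It changes the order in which crossings are
made, which is justified by exchanging 3-cells that act on disjoint parts of a `∘₁`-composite
(`exchanges`, `cell_edge_comp_right`).

Equalities between 3-cells are checked on their lists of whiskers with all typing data erased
(`Cell3.ext_raw`). -/

namespace GrayRewriting

/-! ### Morphisms of free categories: extensionality and induction -/

section FreeMor

variable {V E : Type u} {s t : E → V}

theorem IsPathFrom.src_unique {es : List E} {a b c : V} (h : IsPathFrom s t a es c)
    (h' : IsPathFrom s t b es c) : a = b := by
  cases es with
  | nil => exact Eq.trans h (Eq.symm h')
  | cons e es => exact h.1.symm.trans h'.1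

/-- Dual of `FreeMor.ext'`, for the left part `λ` of a 3-dimensional whisker, where the typing
condition fixes the target and not the source. -/
theorem FreeMor.ext_tgt {p q : FreeMor s t} (h : p.tgt = q.tgt) (h' : p.steps = q.steps) :
    p = q := by
  obtain ⟨a, b, es, hp⟩ := p
  obtain ⟨a', b', es', hq⟩ := q
  cases h
  cases h'
  cases hp.src_unique hq
  rfl

theorem FreeMor.eq_id {p : FreeMor s t} (h : p.steps = []) : p = FreeMor.id s t p.src :=
  FreeMor.ext' rfl h

/-- Induction along the steps of a morphism of a free category. -/
theorem FreeMor.induction {motive : FreeMor s t → Prop} (id : ∀ f, motive (FreeMor.id s t f))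
    (comp : ∀ e p (h : (FreeMor.edge s t e).tgt = p.src), motive p →
      motive ((FreeMor.edge s t e).comp p h)) (p : FreeMor s t) : motive p := by
  obtain ⟨a, b, es, hp⟩ := p
  induction es generalizing a with
  | nil => cases hp; exact id _
  | cons e es ih =>
    obtain ⟨rfl, hp⟩ := hp
    exact comp e ⟨t e, b, es, hp⟩ rfl (ih _ hp)

end FreeMor

/-! ### Whiskering of 2-cells -/

section Dim2

variable {P : Prepolygraph2.{u}}

@[simp] theorem Whisker2.toCell_steps {x y : P.Obj} (w : Whisker2 P x y) :
    w.toCell.steps = [w] := rfl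

/-- Induction along the whiskers of a 2-cell. -/
theorem Cell2.induction {x y : P.Obj} {motive : Cell2 P x y → Prop}
    (id : ∀ f, motive (Cell2.id f))
    (comp : ∀ (w : Whisker2 P x y) (φ : Cell2 P x y) (h : w.toCell.tgt = φ.src), motive φ →
      motive (w.toCell.comp φ h)) (φ : Cell2 P x y) : motive φ :=
  FreeMor.induction id comp φ

@[simp] theorem Cell2.id_steps {x y : P.Obj} (f : Cell1 P.toPrepolygraph1 x y) :
    (Cell2.id f).steps = [] := rfl

@[simp] theorem Cell2.ofGen_steps {x y : P.Obj} (α : P.Gen2 x y) :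
    (Cell2.ofGen α).steps = [⟨Quiver.Path.nil, α, Quiver.Path.nil⟩] := rfl

@[simp] theorem Whisker2.whisk_nil {x y : P.Obj} (w : Whisker2 P x y) :
    Whisker2.whisk Quiver.Path.nil w Quiver.Path.nil = w := by
  simp [Whisker2.whisk]

@[simp] theorem Whisker2.whisk_whisk {x'' x' x y y' y'' : P.Obj}
    (u' : Cell1 P.toPrepolygraph1 x'' x') (u : Cell1 P.toPrepolygraph1 x' x) (w : Whisker2 P x y)
    (v : Cell1 P.toPrepolygraph1 y y') (v' : Cell1 P.toPrepolygraph1 y' y'') :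
    Whisker2.whisk u' (Whisker2.whisk u w v) v' = Whisker2.whisk (u'.comp u) w (v.comp v') := by
  simp [Whisker2.whisk]

@[simp] theorem Cell2.whisk_nil {x y : P.Obj} (φ : Cell2 P x y) :
    Cell2.whisk Quiver.Path.nil φ Quiver.Path.nil = φ := by
  apply FreeMor.ext' <;> simp

end Dim2

/-! ### 3-cells with typing data erased -/

/-- A 3-dimensional whisker without typing conditions. -/
structure RawWhisker3 (P : Prepolygraph3.{u}) (x y : P.Obj) where
  {a b : P.Obj}
  lam : List (Whisker2 P.toPrepolygraph2 x y)
  l : Cell1 P.toPrepolygraph1 x a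
  gen : P.Gen3 a b
  r : Cell1 P.toPrepolygraph1 b y
  rho : List (Whisker2 P.toPrepolygraph2 x y)

section Dim3

variable {P : Prepolygraph3.{u}}

/-- The raw whisker `u ∘₀ S ∘₀ v`. -/
def RawWhisker3.whisk {x' x y y' : P.Obj} (u : Cell1 P.toPrepolygraph1 x' x)
    (v : Cell1 P.toPrepolygraph1 y y') (S : RawWhisker3 P x y) : RawWhisker3 P x' y' where
  lam := S.lam.map fun w => Whisker2.whisk u w v
  l := u.comp S.l
  gen := S.gen
  r := S.r.comp v
  rho := S.rho.map fun w => Whisker2.whisk u w v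

/-- The raw whisker `μ ∘₁ S ∘₁ ν`. -/
def RawWhisker3.ctx {x y : P.Obj} (mu nu : List (Whisker2 P.toPrepolygraph2 x y))
    (S : RawWhisker3 P x y) : RawWhisker3 P x y where
  lam := mu ++ S.lam
  l := S.l
  gen := S.gen
  r := S.r
  rho := S.rho ++ nu

@[simp] theorem RawWhisker3.ctx_nil {x y : P.Obj} (S : RawWhisker3 P x y) :
    RawWhisker3.ctx [] [] S = S := by
  simp [RawWhisker3.ctx]

@[simp] theorem RawWhisker3.ctx_nil_nil {x y : P.Obj} :
    RawWhisker3.ctx (P := P) (x := x) (y := y) [] [] = id :=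
  funext RawWhisker3.ctx_nil

@[simp] theorem RawWhisker3.ctx_ctx {x y : P.Obj}
    (mu nu mu' nu' : List (Whisker2 P.toPrepolygraph2 x y)) (S : RawWhisker3 P x y) :
    RawWhisker3.ctx mu' nu' (RawWhisker3.ctx mu nu S) =
      RawWhisker3.ctx (mu' ++ mu) (nu ++ nu') S := by
  simp [RawWhisker3.ctx]

@[simp] theorem RawWhisker3.whisk_whisk {x'' x' x y y' y'' : P.Obj}
    (u' : Cell1 P.toPrepolygraph1 x'' x') (u : Cell1 P.toPrepolygraph1 x' x)
    (v : Cell1 P.toPrepolygraph1 y y') (v' : Cell1 P.toPrepolygraph1 y' y'')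
    (S : RawWhisker3 P x y) :
    RawWhisker3.whisk u' v' (RawWhisker3.whisk u v S) =
      RawWhisker3.whisk (u'.comp u) (v.comp v') S := by
  simp [RawWhisker3.whisk]

@[simp] theorem RawWhisker3.whisk_ctx {x' x y y' : P.Obj} (u : Cell1 P.toPrepolygraph1 x' x)
    (v : Cell1 P.toPrepolygraph1 y y') (mu nu : List (Whisker2 P.toPrepolygraph2 x y))
    (S : RawWhisker3 P x y) :
    RawWhisker3.whisk u v (RawWhisker3.ctx mu nu S) =
      RawWhisker3.ctx (mu.map fun w => Whisker2.whisk u w v)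
        (nu.map fun w => Whisker2.whisk u w v) (RawWhisker3.whisk u v S) := by
  simp [RawWhisker3.whisk, RawWhisker3.ctx]

/-- The underlying raw whisker. -/
def Whisker3.raw {x y : P.Obj} (S : Whisker3 P x y) : RawWhisker3 P x y :=
  ⟨S.lam.steps, S.l, S.gen, S.r, S.rho.steps⟩

/-- Erasure loses nothing: `l`, `A` and `r` determine the target of `λ` and the source of `ρ`, and a
2-cell is recovered from its steps and one endpoint. -/
theorem Whisker3.raw_injective {x y : P.Obj} :
    Function.Injective (Whisker3.raw (P := P) (x := x) (y := y)) := by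
  rintro ⟨lam, l, A, r, rho, h₁, h₂⟩ ⟨lam', l', A', r', rho', h₁', h₂'⟩ h
  simp only [Whisker3.raw, RawWhisker3.mk.injEq] at h
  obtain ⟨rfl, rfl, h, hl, hA, hr, h'⟩ := h
  cases hl
  cases hA
  cases hr
  cases FreeMor.ext_tgt (h₁.trans h₁'.symm) h
  cases FreeMor.ext' (h₂.symm.trans h₂') h'
  rfl

/-- The underlying raw whiskers of a 3-cell. -/
def Cell3.raw {x y : P.Obj} (F : Cell3 P x y) : List (RawWhisker3 P x y) :=
  F.steps.map Whisker3.raw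

/-- Turns an equation of 3-cells into equations of 1-cells and of lists free of proof-carrying data,
which `simp` can settle. Targets need no check, as the source and the steps determine them. -/
theorem Cell3.ext_raw {x y : P.Obj} {F G : Cell3 P x y} (h : F.src.src = G.src.src)
    (h' : F.src.steps = G.src.steps) (h'' : F.raw = G.raw) : F = G :=
  FreeMor.ext' (FreeMor.ext' h h') (Whisker3.raw_injective.list_map h'')

@[simp] theorem Cell3.freeMorId_raw {x y : P.Obj} (φ : Cell2 P.toPrepolygraph2 x y) :
    Cell3.raw (FreeMor.id Whisker3.src Whisker3.tgt φ) = [] := rfl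

@[simp] theorem Cell3.edge_raw {x y : P.Obj} (S : Whisker3 P x y) :
    Cell3.raw (FreeMor.edge Whisker3.src Whisker3.tgt S) = [S.raw] := rfl

@[simp] theorem Cell3.comp_raw {x y : P.Obj} (F G : Cell3 P x y) (h : F.tgt = G.src) :
    Cell3.raw (F.comp G h) = F.raw ++ G.raw :=
  List.map_append

@[simp] theorem Cell3.ofGen_raw {x y : P.Obj} (A : P.Gen3 x y) :
    (Cell3.ofGen A).raw = [⟨[], Quiver.Path.nil, A, Quiver.Path.nil, []⟩] := rfl

@[simp] theorem Cell3.whisk_raw {x' x y y' : P.Obj} (u : Cell1 P.toPrepolygraph1 x' x)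
    (F : Cell3 P x y) (v : Cell1 P.toPrepolygraph1 y y') :
    (Cell3.whisk u F v).raw = F.raw.map (RawWhisker3.whisk u v) := by
  simp [Cell3.raw, Cell3.whisk, Whisker3.whisk, Whisker3.raw, RawWhisker3.whisk]

@[simp] theorem Cell3.ctx_raw {x y : P.Obj} (mu : Cell2 P.toPrepolygraph2 x y) (F : Cell3 P x y)
    (nu : Cell2 P.toPrepolygraph2 x y) (h₁ h₂) :
    (Cell3.ctx mu F nu h₁ h₂).raw = F.raw.map (RawWhisker3.ctx mu.steps nu.steps) := by
  simp only [Cell3.raw, Cell3.ctx, List.map_pmap, List.map_map]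
  -- The membership proofs carried by `pmap` enter only the typing conditions, so they disappear
  -- under erasure.
  exact List.pmap_eq_map (f := RawWhisker3.ctx mu.steps nu.steps ∘ Whisker3.raw) _

@[simp] theorem Cell3.pre_raw {x y : P.Obj} (mu : Cell2 P.toPrepolygraph2 x y) (F : Cell3 P x y)
    (h) : (Cell3.pre mu F h).raw = F.raw.map (RawWhisker3.ctx mu.steps []) :=
  Cell3.ctx_raw _ _ _ _ _

@[simp] theorem Cell3.post_raw {x y : P.Obj} (F : Cell3 P x y) (nu : Cell2 P.toPrepolygraph2 x y)
    (h) : (Cell3.post F nu h).raw = F.raw.map (RawWhisker3.ctx [] nu.steps) :=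
  Cell3.ctx_raw _ _ _ _ _

theorem Cell3.comp_assoc {x y : P.Obj} (F G H : Cell3 P x y) (h : F.tgt = G.src)
    (h' : G.tgt = H.src) : (F.comp G h).comp H (by simp [h']) = F.comp (G.comp H h') (by simp [h]) := by
  apply Cell3.ext_raw <;> simp

theorem Cell3.ctx_comp {x y : P.Obj} (mu nu : Cell2 P.toPrepolygraph2 x y) (F G : Cell3 P x y)
    (h : F.tgt = G.src) (h₁ : mu.tgt = F.src.src) (h₂ : F.src.tgt = nu.src) :
    Cell3.ctx mu (F.comp G h) nu (by simp [h₁]) (by simp [h₂]) =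
      (Cell3.ctx mu F nu h₁ h₂).comp
        (Cell3.ctx mu G nu (by simp [← h, h₁]) (by simp [← h, h₂]))
        (by apply FreeMor.ext' <;> simp [h]) := by
  apply Cell3.ext_raw <;> simp

theorem Cell3.whisk_comp {x' x y y' : P.Obj} (u : Cell1 P.toPrepolygraph1 x' x)
    (F G : Cell3 P x y) (v : Cell1 P.toPrepolygraph1 y y') (h : F.tgt = G.src) :
    Cell3.whisk u (F.comp G h) v =
      (Cell3.whisk u F v).comp (Cell3.whisk u G v) (by simp [h]) := by
  apply Cell3.ext_raw <;> simp

end Dim3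

/-! ### Congruence and the exchange of 3-cells acting on disjoint parts -/

namespace Prepolygraph4

variable {Q : Prepolygraph4.{u}} {x y : Q.Obj}

theorem StdCong.of_eq {F G : Cell3 Q.toPrepolygraph3 x y} (h : F = G) : Q.StdCong F G :=
  h ▸ .refl F

theorem StdCong.comp_left (F : Cell3 Q.toPrepolygraph3 x y) {G G' : Cell3 Q.toPrepolygraph3 x y}
    (h : F.tgt = G.src) (hG : Q.StdCong G G') :
    Q.StdCong (F.comp G h) (F.comp G' (h.trans hG.parallel.1)) :=
  .comp _ _ (.refl F) hG

theorem StdCong.comp_right {F F' : Cell3 Q.toPrepolygraph3 x y} (G : Cell3 Q.toPrepolygraph3 x y)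
    (h : F.tgt = G.src) (hF : Q.StdCong F F') :
    Q.StdCong (F.comp G h) (F'.comp G (hF.parallel.2.symm.trans h)) :=
  .comp _ _ hF (.refl G)

theorem StdCong.pre {F G : Cell3 Q.toPrepolygraph3 x y} (mu : Cell2 Q.toPrepolygraph2 x y)
    (h : mu.tgt = F.src.src) (hFG : Q.StdCong F G) :
    Q.StdCong (Cell3.pre mu F h) (Cell3.pre mu G (by simp [h, hFG.parallel.1])) := by
  have := StdCong.ctx mu (Cell2.id F.src.tgt) h rfl (by simp [h, hFG.parallel.1])
    (by simp [hFG.parallel.1]) hFG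
  -- The identity 2-cell in `Cell3.pre` is formed from the cell itself. Those for `F` and `G` agree
  -- because congruent 3-cells are parallel.
  refine this.trans (.of_eq ?_)
  apply Cell3.ext_raw <;> simp [hFG.parallel.1]

theorem StdCong.post {F G : Cell3 Q.toPrepolygraph3 x y} (nu : Cell2 Q.toPrepolygraph2 x y)
    (h : F.src.tgt = nu.src) (hFG : Q.StdCong F G) :
    Q.StdCong (Cell3.post F nu h) (Cell3.post G nu (by simp [← h, hFG.parallel.1])) := by
  have := StdCong.ctx (Cell2.id F.src.src) nu rfl h (by simp [hFG.parallel.1])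
    (by simp [← h, hFG.parallel.1]) hFG
  refine this.trans (.of_eq ?_)
  apply Cell3.ext_raw <;> simp [hFG.parallel.1]

/-- The two ways of applying `F` and `G` to `F.src ∘₁ G.src` are congruent. -/
def Exchanges (F G : Cell3 Q.toPrepolygraph3 x y) : Prop :=
  ∀ h : F.src.tgt = G.src.src,
    Q.StdCong
      ((Cell3.post F G.src h).comp (Cell3.pre F.tgt G (by simp [h])) (by simp))
      ((Cell3.pre F.src G h).comp (Cell3.post F G.tgt (by simp [h])) (by simp))

theorem exchanges_id_left (φ : Cell2 Q.toPrepolygraph2 x y) (G : Cell3 Q.toPrepolygraph3 x y) :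
    Exchanges (FreeMor.id _ _ φ) G := fun h => .of_eq (by
  apply Cell3.ext_raw <;> simp)

theorem exchanges_id_right (F : Cell3 Q.toPrepolygraph3 x y) (φ : Cell2 Q.toPrepolygraph2 x y) :
    Exchanges F (FreeMor.id _ _ φ) := fun h => .of_eq (by
  apply Cell3.ext_raw <;> simp)

/-- An independence generator put in context: the right part of `S` and the left part of `T` form
the middle 2-cell `χ`, and the outer parts `S.lam` and `T.rho` are the context. -/
theorem exchanges_edge (hQ : Q.HasIndependence) (S T : Whisker3 Q.toPrepolygraph3 x y) :
    Exchanges (FreeMor.edge _ _ S) (FreeMor.edge _ _ T) := fun h => by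
  obtain ⟨G, hG₁, hG₂⟩ := hQ S.l S.gen S.r (S.rho.comp T.lam (by simpa using h)) T.l T.gen T.r
    S.rho_src T.lam_tgt
  have key := StdCong.gen G
  rw [hG₁, hG₂] at key
  replace key := StdCong.ctx S.lam T.rho
    (by simp [Cell3.indepSrc, Cell3.actTop, S.lam_tgt])
    (by simp [Cell3.indepSrc, Cell3.actTop, ← T.rho_src])
    (by simp [Cell3.indepTgt, Cell3.actBot, S.lam_tgt])
    (by simp [Cell3.indepTgt, Cell3.actBot, ← T.rho_src]) key
  refine (StdCong.of_eq ?_).trans (key.trans (StdCong.of_eq ?_)) <;>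
    apply Cell3.ext_raw <;>
    simp [Cell3.indepSrc, Cell3.indepTgt, Cell3.actTop, Cell3.actBot, RawWhisker3.ctx,
      RawWhisker3.whisk, Whisker3.raw]

/-- Two exchange squares are pasted: `G` is carried back past `F'`, then past `F`. -/
theorem exchanges_comp_left {F F' G : Cell3 Q.toPrepolygraph3 x y} (h : F.tgt = F'.src)
    (hF : Exchanges F G) (hF' : Exchanges F' G) : Exchanges (F.comp F' h) G := fun h₁ => by
  have h₁' : F.src.tgt = G.src.src := h₁
  have h₂ : F'.src.tgt = G.src.src := by rw [← h]; simpa using h₁'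
  refine (StdCong.of_eq ?_).trans <| (StdCong.comp_left (Cell3.post F G.src h₁') (by simp [h])
    (hF' h₂)).trans <| (StdCong.of_eq ?_).trans <| (StdCong.comp_right
      (Cell3.post F' G.tgt (by simp [h₂])) (by simp [h]) (hF h₁')).trans <| StdCong.of_eq ?_ <;>
    apply Cell3.ext_raw <;> simp [h]

theorem exchanges_comp_right {F G G' : Cell3 Q.toPrepolygraph3 x y} (h : G.tgt = G'.src)
    (hG : Exchanges F G) (hG' : Exchanges F G') : Exchanges F (G.comp G' h) := fun h₁ => by
  have h₁' : F.src.tgt = G.src.src := h₁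
  have h₂ : F.src.tgt = G'.src.src := by rw [← h]; simpa using h₁'
  refine (StdCong.of_eq ?_).trans <| (StdCong.comp_right (Cell3.pre F.tgt G' (by simp [h₂]))
    (by simp [h]) (hG h₁')).trans <| (StdCong.of_eq ?_).trans <| (StdCong.comp_left
      (Cell3.pre F.src G h₁') (by simp [h]) (hG' h₂)).trans <| StdCong.of_eq ?_ <;>
    apply Cell3.ext_raw <;> simp [h]

/-- Squares are pasted along the steps of `F` and, for each of them, along the steps of `G`, which
leaves only pairs of single steps. -/
theorem exchanges (hQ : Q.HasIndependence) (F G : Cell3 Q.toPrepolygraph3 x y) :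
    Exchanges F G := by
  induction F using FreeMor.induction with
  | id φ => exact exchanges_id_left φ G
  | comp S F h ih =>
    refine exchanges_comp_left h ?_ ih
    clear ih h
    induction G using FreeMor.induction with
    | id φ => exact exchanges_id_right _ φ
    | comp T G h ih => exact exchanges_comp_right h (exchanges_edge hQ S T) ih

end Prepolygraph4

/-! ### Erased form of the two sides of an interchange -/

section Sides

variable {P : Prepolygraph3.{u}} {x y z : P.Obj}

attribute [simp] Cell3.lrLeft_src Cell3.lrLeft_tgt Cell3.rlLeft_src Cell3.rlLeft_tgt
  Cell3.lrRight_src Cell3.lrRight_tgt Cell3.rlRight_src Cell3.rlRight_tgt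

@[simp] theorem Cell3.lrLeft_raw (F : Cell3 P x y) (ψ : Cell2 P.toPrepolygraph2 y z) :
    (F.lrLeft ψ).raw = F.raw.map fun S => RawWhisker3.ctx []
      (ψ.steps.map fun v => Whisker2.whisk F.src.tgt v Quiver.Path.nil)
      (RawWhisker3.whisk Quiver.Path.nil ψ.src S) := by
  simp [Cell3.lrLeft]

@[simp] theorem Cell3.rlLeft_raw (F : Cell3 P x y) (ψ : Cell2 P.toPrepolygraph2 y z) :
    (F.rlLeft ψ).raw = F.raw.map fun S => RawWhisker3.ctx
      (ψ.steps.map fun v => Whisker2.whisk F.src.src v Quiver.Path.nil) []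
      (RawWhisker3.whisk Quiver.Path.nil ψ.tgt S) := by
  simp [Cell3.rlLeft]

@[simp] theorem Cell3.lrRight_raw (φ : Cell2 P.toPrepolygraph2 x y) (F : Cell3 P y z) :
    (Cell3.lrRight φ F).raw = F.raw.map fun S => RawWhisker3.ctx
      (φ.steps.map fun w => Whisker2.whisk Quiver.Path.nil w F.src.src) []
      (RawWhisker3.whisk φ.tgt Quiver.Path.nil S) := by
  simp [Cell3.lrRight]

@[simp] theorem Cell3.rlRight_raw (φ : Cell2 P.toPrepolygraph2 x y) (F : Cell3 P y z) :
    (Cell3.rlRight φ F).raw = F.raw.map fun S => RawWhisker3.ctx []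
      (φ.steps.map fun w => Whisker2.whisk Quiver.Path.nil w F.src.tgt)
      (RawWhisker3.whisk φ.src Quiver.Path.nil S) := by
  simp [Cell3.rlRight]

end Sides

/-! ### The recursive structure of `X_{φ,ψ}` -/

namespace Interchanger

variable {P : Prepolygraph3.{u}} (X : Interchanger P) {x y z : P.Obj}

attribute [simp] whiskerCell_src whiskerCell_tgt cell_src cell_tgt

@[simp] theorem whiskerCell_raw (w : Whisker2 P.toPrepolygraph2 x y)
    (v : Whisker2 P.toPrepolygraph2 y z) :
    (X.whiskerCell w v).raw = [⟨[], w.l, X.gen w.gen (w.r.comp v.l) v.gen, v.r, []⟩] := by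
  simp [whiskerCell, RawWhisker3.whisk]

/-- The 3-cell that moves the whisker `w` past `ψ`. -/
def row (w : Whisker2 P.toPrepolygraph2 x y) (ψ : Cell2 P.toPrepolygraph2 y z) : Cell3 P x z :=
  (X.rowAux w ψ.steps ψ.src ψ.tgt ψ.isPath).1

@[simp] theorem row_src (w : Whisker2 P.toPrepolygraph2 x y) (ψ : Cell2 P.toPrepolygraph2 y z) :
    (X.row w ψ).src = Cell2.lr w.toCell ψ := (X.rowAux w ψ.steps ψ.src ψ.tgt ψ.isPath).2.1

@[simp] theorem row_tgt (w : Whisker2 P.toPrepolygraph2 x y) (ψ : Cell2 P.toPrepolygraph2 y z) :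
    (X.row w ψ).tgt = Cell2.rl w.toCell ψ := (X.rowAux w ψ.steps ψ.src ψ.tgt ψ.isPath).2.2

@[simp] theorem row_id_raw (w : Whisker2 P.toPrepolygraph2 x y)
    (g : Cell1 P.toPrepolygraph1 y z) : (X.row w (Cell2.id g)).raw = [] := rfl

@[simp] theorem row_edge_comp_raw (w : Whisker2 P.toPrepolygraph2 x y)
    (v : Whisker2 P.toPrepolygraph2 y z) (ψ : Cell2 P.toPrepolygraph2 y z)
    (h : v.toCell.tgt = ψ.src) :
    (X.row w (FreeMor.comp v.toCell ψ h)).raw =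
      (X.whiskerCell w v).raw.map (RawWhisker3.ctx []
        (ψ.steps.map fun v => Whisker2.whisk w.tgt v Quiver.Path.nil)) ++
      (X.row w ψ).raw.map (RawWhisker3.ctx [Whisker2.whisk w.src v Quiver.Path.nil] []) := by
  -- `rowAux` recurses on the list of whiskers, so its equation applies only once `ψ` is taken apart
  -- and its source is identified with the target of `v`.
  obtain ⟨g, g', vs, hψ⟩ := ψ
  cases h
  exact List.map_append.trans
    (congrArg₂ _ (Cell3.post_raw _ _ _) (Cell3.pre_raw _ _ _))

@[simp] theorem row_edge_raw (w : Whisker2 P.toPrepolygraph2 x y)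
    (v : Whisker2 P.toPrepolygraph2 y z) :
    (X.row w v.toCell).raw = (X.whiskerCell w v).raw := by
  have := X.row_edge_comp_raw w v (Cell2.id v.tgt) rfl
  rw [show v.toCell.comp (Cell2.id v.tgt) rfl = v.toCell from FreeMor.ext' rfl rfl] at this
  simpa using this

@[simp] theorem cell_id_raw (f : Cell1 P.toPrepolygraph1 x y)
    (ψ : Cell2 P.toPrepolygraph2 y z) : (X.cell (Cell2.id f) ψ).raw = [] := rfl

@[simp] theorem cell_edge_comp_raw (w : Whisker2 P.toPrepolygraph2 x y)
    (φ : Cell2 P.toPrepolygraph2 x y)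
    (h : w.toCell.tgt = φ.src)
    (ψ : Cell2 P.toPrepolygraph2 y z) :
    (X.cell (FreeMor.comp w.toCell φ h) ψ).raw =
      (X.cell φ ψ).raw.map (RawWhisker3.ctx [Whisker2.whisk Quiver.Path.nil w ψ.src] []) ++
      (X.row w ψ).raw.map (RawWhisker3.ctx []
        (φ.steps.map fun w => Whisker2.whisk Quiver.Path.nil w ψ.tgt)) := by
  obtain ⟨f, f', ws, hφ⟩ := φ
  cases h
  exact List.map_append.trans
    (congrArg₂ _ (Cell3.pre_raw _ _ _) (Cell3.post_raw _ _ _))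

@[simp] theorem cell_edge_raw (w : Whisker2 P.toPrepolygraph2 x y)
    (ψ : Cell2 P.toPrepolygraph2 y z) : (X.cell w.toCell ψ).raw = (X.row w ψ).raw := by
  have := X.cell_edge_comp_raw w (Cell2.id w.tgt) rfl ψ
  rw [show w.toCell.comp (Cell2.id w.tgt) rfl = w.toCell from FreeMor.ext' rfl rfl] at this
  simpa using this

@[simp] theorem cell_raw_id (φ : Cell2 P.toPrepolygraph2 x y)
    (g : Cell1 P.toPrepolygraph1 y z) : (X.cell φ (Cell2.id g)).raw = [] := by
  induction φ using Cell2.induction with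
  | id f => simp
  | comp w φ h ih => simp [ih]

/-- `φ ∘₁ w` is moved past `ψ` by moving first `w`, then `φ`. -/
theorem cell_comp_edge_raw (φ : Cell2 P.toPrepolygraph2 x y) (w : Whisker2 P.toPrepolygraph2 x y)
    (h : φ.tgt = w.toCell.src) (ψ : Cell2 P.toPrepolygraph2 y z) :
    (X.cell (φ.comp w.toCell h) ψ).raw =
      (X.row w ψ).raw.map (RawWhisker3.ctx
        (φ.steps.map fun w => Whisker2.whisk Quiver.Path.nil w ψ.src) []) ++
      (X.cell φ ψ).raw.map (RawWhisker3.ctx [] [Whisker2.whisk Quiver.Path.nil w ψ.tgt]) := by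
  -- `cellAux` peels off the first whisker, whereas here the last one is split off. In both
  -- descriptions `w` moves first, so the two lists of moves coincide and no congruence is involved.
  induction φ using Cell2.induction with
  | id f =>
    have : (Cell2.id f).comp w.toCell h = w.toCell := FreeMor.ext' h rfl
    simp [this]
  | comp w' φ h' ih =>
    have hw : φ.tgt = w.toCell.src := h
    have : (w'.toCell.comp φ h').comp w.toCell h =
      w'.toCell.comp (φ.comp w.toCell hw) (by simpa using h') := FreeMor.ext' rfl rfl
    rw [this, cell_edge_comp_raw, ih, cell_edge_comp_raw]
    simp [Function.comp_def]

theorem whisk_whiskerCell_raw {x' z' : P.Obj} (u : Cell1 P.toPrepolygraph1 x' x)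
    (w : Whisker2 P.toPrepolygraph2 x y) (v : Whisker2 P.toPrepolygraph2 y z)
    (u' : Cell1 P.toPrepolygraph1 z z') :
    (X.whiskerCell w v).raw.map (RawWhisker3.whisk u u') =
      (X.whiskerCell (Whisker2.whisk u w Quiver.Path.nil)
        (Whisker2.whisk Quiver.Path.nil v u')).raw := by
  simp [RawWhisker3.whisk, Whisker2.whisk]

theorem whisk_row_raw {x' z' : P.Obj} (u : Cell1 P.toPrepolygraph1 x' x)
    (w : Whisker2 P.toPrepolygraph2 x y) (ψ : Cell2 P.toPrepolygraph2 y z)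
    (u' : Cell1 P.toPrepolygraph1 z z') :
    (X.row w ψ).raw.map (RawWhisker3.whisk u u') =
      (X.row (Whisker2.whisk u w Quiver.Path.nil) (Cell2.whisk Quiver.Path.nil ψ u')).raw := by
  induction ψ using Cell2.induction with
  | id f => rfl
  | comp v ψ h ih =>
    have : Cell2.whisk Quiver.Path.nil (v.toCell.comp ψ h) u' =
      (Whisker2.whisk Quiver.Path.nil v u').toCell.comp
        (Cell2.whisk Quiver.Path.nil ψ u') (by simp [← h]) := by
      apply FreeMor.ext' <;> simp
    rw [this, row_edge_comp_raw, row_edge_comp_raw, ← ih, ← whisk_whiskerCell_raw]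
    simp [-whiskerCell_raw, Function.comp_def]

/-- Outer whiskering only lengthens the outermost 1-cells of each crossing and leaves the 1-cell
between the two generators alone. This carries the naturality generators, which have no outer
1-cells around `α` or `β`, to arbitrary whiskers. -/
theorem whisk_cell {x' z' : P.Obj} (u : Cell1 P.toPrepolygraph1 x' x)
    (φ : Cell2 P.toPrepolygraph2 x y) (ψ : Cell2 P.toPrepolygraph2 y z)
    (u' : Cell1 P.toPrepolygraph1 z z') :
    Cell3.whisk u (X.cell φ ψ) u' =
      X.cell (Cell2.whisk u φ Quiver.Path.nil) (Cell2.whisk Quiver.Path.nil ψ u') := by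
  apply Cell3.ext_raw
  · simp
  · simp [Function.comp_def]
  rw [Cell3.whisk_raw]
  induction φ using Cell2.induction with
  | id f => rfl
  | comp w φ h ih =>
    have : Cell2.whisk u (w.toCell.comp φ h) Quiver.Path.nil =
      (Whisker2.whisk u w Quiver.Path.nil).toCell.comp
        (Cell2.whisk u φ Quiver.Path.nil) (by simp [← h]) := by
      apply FreeMor.ext' <;> simp
    rw [this, cell_edge_comp_raw, cell_edge_comp_raw, ← ih, ← whisk_row_raw]
    simp [Function.comp_def]

end Interchanger

/-! ### Splitting the second argument of `X_{φ,ψ}` -/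

namespace Prepolygraph4

open Interchanger

variable {Q : Prepolygraph4.{u}} (X : Interchanger Q.toPrepolygraph3) {x y z : Q.Obj}

/-- Up to congruence, `φ` is moved past `v ∘₁ ψ` by moving it first past `v`, then past `ψ`. -/
theorem cell_edge_comp_right (hQ : Q.HasIndependence) (φ : Cell2 Q.toPrepolygraph2 x y)
    (v : Whisker2 Q.toPrepolygraph2 y z) (ψ : Cell2 Q.toPrepolygraph2 y z)
    (h : v.toCell.tgt = ψ.src) :
    Q.StdCong (X.cell φ (FreeMor.comp v.toCell ψ h))
      ((Cell3.post (X.cell φ v.toCell) (Cell2.whisk φ.tgt ψ Quiver.Path.nil)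
          (by simp [← h])).comp
        (Cell3.pre (Cell2.whisk φ.src v.toCell Quiver.Path.nil) (X.cell φ ψ) (by simp [← h]))
        (by apply FreeMor.ext' <;> simp [← h])) := by
  have h' : v.tgt = ψ.src := h
  induction φ using Cell2.induction with
  | id f => exact .of_eq (by apply Cell3.ext_raw <;> simp)
  | comp w φ hφ ih =>
    have hφ' : w.tgt = φ.src := hφ
    -- With `X_{φ, v ∘₁ ψ}` split by induction, the crossings come in the order `(φ,v)`, `(φ,ψ)`,
    -- `(w,v)`, `(w,ψ)`, and the two middle ones must be swapped. Once `φ` has passed `v`, the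
    -- 2-cell reads `w, v, φ, ψ`, so `X_{w,v}` and `X_{φ,ψ}` act on disjoint parts and exchange.
    have key := StdCong.comp_right
      (Cell3.pre (Cell2.whisk w.src v.toCell Quiver.Path.nil)
        (Cell3.post (X.row w ψ) (Cell2.whisk Quiver.Path.nil φ ψ.tgt) (by simp [hφ']))
        (by simp [h']))
      (by apply FreeMor.ext' <;> simp [h', hφ'])
      (StdCong.comp_left
        (Cell3.pre (Cell2.whisk Quiver.Path.nil w.toCell v.src)
          (Cell3.post (X.cell φ v.toCell) (Cell2.whisk φ.tgt ψ Quiver.Path.nil) (by simp [h']))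
          (by simp [hφ']))
        (by apply FreeMor.ext' <;> simp [h', hφ'])
        (exchanges hQ (X.row w v.toCell) (X.cell φ ψ) (by simp [h', hφ'])).symm)
    refine (StdCong.of_eq ?_).trans <| (StdCong.comp_right
      (Cell3.post (X.row w (v.toCell.comp ψ h)) (Cell2.whisk Quiver.Path.nil φ ψ.tgt)
        (by simp [hφ']))
      (by apply FreeMor.ext' <;> simp [hφ'])
      (StdCong.pre (Cell2.whisk Quiver.Path.nil w.toCell v.src) (by simp [hφ']) ih)).trans <|
      (StdCong.of_eq ?_).trans <| key.trans (StdCong.of_eq ?_) <;>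
    apply Cell3.ext_raw <;> simp [h', hφ', Function.comp_def]

end Prepolygraph4

/-! ### Naturality of interchange for arbitrary 2-cells -/

namespace Prepolygraph4

open Interchanger

variable {Q : Prepolygraph4.{u}} (X : Interchanger Q.toPrepolygraph3) {x y z : Q.Obj}

/-- Interchange is natural in its left argument. -/
theorem naturality_left (hQ : Q.HasIndependence) (hX : Q.HasNaturalityLeft X) (A : Q.Gen3 x y)
    (ψ : Cell2 Q.toPrepolygraph2 y z) :
    Q.StdCong (((Cell3.ofGen A).lrLeft ψ).comp (X.cell (Q.tgt3 A) ψ) (by simp))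
      ((X.cell (Q.src3 A) ψ).comp ((Cell3.ofGen A).rlLeft ψ) (by simp)) := by
  induction ψ using Cell2.induction with
  | id g => exact .of_eq (by apply Cell3.ext_raw <;> simp)
  | comp v ψ h ih =>
    have h' : v.tgt = ψ.src := h
    have hv : Q.StdCong
        (((Cell3.ofGen A).lrLeft v.toCell).comp (X.cell (Q.tgt3 A) v.toCell) (by simp))
        ((X.cell (Q.src3 A) v.toCell).comp ((Cell3.ofGen A).rlLeft v.toCell) (by simp)) := by
      -- The generator accounts for `v.l` and `v.gen`. Whiskering it on the right by `v.r` gives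
      -- naturality against the whole whisker.
      obtain ⟨G, hG₁, hG₂⟩ := hX A v.l v.gen
      have key := StdCong.whisk Quiver.Path.nil v.r (StdCong.gen G)
      rw [hG₁, hG₂, Cell3.whisk_comp, Cell3.whisk_comp] at key
      simp only [whisk_cell] at key
      refine (StdCong.of_eq ?_).trans (key.trans (StdCong.of_eq ?_)) <;>
        apply Cell3.ext_raw <;> simp [Whisker2.toCell_eq, Cell2.whisk_whisk]
    -- Writing `A : φ ⇛ φ'`, `X_{φ', v ∘₁ ψ}` is split into `X_{φ',v}` and `X_{φ',ψ}`, then `A` is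
    -- carried past the first by `hv` and past the second by `ih`, and the pieces are reassembled
    -- into `X_{φ, v ∘₁ ψ}`.
    refine (StdCong.comp_left _ (by simp) (cell_edge_comp_right X hQ _ v ψ h)).trans <|
      (StdCong.of_eq ?_).trans <|
      (StdCong.comp_right
        (Cell3.pre (Cell2.whisk (Q.src3 A).src v.toCell Quiver.Path.nil) (X.cell (Q.tgt3 A) ψ)
          (by simp [h']))
        (by apply FreeMor.ext' <;> simp [h'])
        (StdCong.post (Cell2.whisk (Q.src3 A).tgt ψ Quiver.Path.nil) (by simp [h']) hv)).trans <|
      (StdCong.of_eq ?_).trans <|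
      (StdCong.comp_left
        (Cell3.post (X.cell (Q.src3 A) v.toCell) (Cell2.whisk (Q.src3 A).tgt ψ Quiver.Path.nil)
          (by simp [h']))
        (by apply FreeMor.ext' <;> simp [h'])
        (StdCong.pre (Cell2.whisk (Q.src3 A).src v.toCell Quiver.Path.nil)
          (by simp [h']) ih)).trans <|
      (StdCong.of_eq ?_).trans <|
      StdCong.comp_right _ (by apply FreeMor.ext' <;> simp)
        (cell_edge_comp_right X hQ _ v ψ h).symm <;>
    apply Cell3.ext_raw <;> simp [h']

/-- Interchange is natural in its right argument. -/
theorem naturality_right (hX : Q.HasNaturalityRight X) (φ : Cell2 Q.toPrepolygraph2 x y)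
    (B : Q.Gen3 y z) :
    Q.StdCong ((Cell3.lrRight φ (Cell3.ofGen B)).comp (X.cell φ (Q.tgt3 B)) (by simp))
      ((X.cell φ (Q.src3 B)).comp (Cell3.rlRight φ (Cell3.ofGen B)) (by simp)) := by
  induction φ using Cell2.induction with
  | id f => exact .of_eq (by apply Cell3.ext_raw <;> simp)
  | comp w φ h ih =>
    have h' : w.tgt = φ.src := h
    have hw : Q.StdCong
        ((Cell3.lrRight w.toCell (Cell3.ofGen B)).comp (X.row w (Q.tgt3 B)) (by simp))
        ((X.row w (Q.src3 B)).comp (Cell3.rlRight w.toCell (Cell3.ofGen B)) (by simp)) := by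
      have hrow (ψ : Cell2 Q.toPrepolygraph2 y z) : (X.row w ψ).raw =
          (X.cell (Cell2.whisk w.l (Cell2.ofGen w.gen) w.r) ψ).raw := by
        rw [← Whisker2.toCell_eq, cell_edge_raw]
      obtain ⟨G, hG₁, hG₂⟩ := hX w.gen w.r B
      have key := StdCong.whisk w.l Quiver.Path.nil (StdCong.gen G)
      rw [hG₁, hG₂, Cell3.whisk_comp, Cell3.whisk_comp] at key
      simp only [whisk_cell, Cell2.whisk_whisk] at key
      refine (StdCong.of_eq ?_).trans (key.trans (StdCong.of_eq ?_)) <;>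
        apply Cell3.ext_raw <;> simp [Whisker2.toCell_eq, hrow]
    -- The splitting of `X_{w ∘₁ φ, ψ}` is its defining recursion, hence a strict equality. `B` is
    -- carried past the crossings of `φ` by `ih`, then past those of `w` by `hw`.
    refine (StdCong.of_eq ?_).trans <|
      (StdCong.comp_right
        (Cell3.post (X.row w (Q.tgt3 B)) (Cell2.whisk Quiver.Path.nil φ (Q.src3 B).tgt)
          (by simp [h']))
        (by apply FreeMor.ext' <;> simp [h'])
        (StdCong.pre (Cell2.whisk Quiver.Path.nil w.toCell (Q.src3 B).src)
          (by simp [h']) ih)).trans <|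
      (StdCong.of_eq ?_).trans <|
      (StdCong.comp_left
        (Cell3.pre (Cell2.whisk Quiver.Path.nil w.toCell (Q.src3 B).src) (X.cell φ (Q.src3 B))
          (by simp [h']))
        (by apply FreeMor.ext' <;> simp [h'])
        (StdCong.post (Cell2.whisk Quiver.Path.nil φ (Q.src3 B).tgt) (by simp [h']) hw)).trans <|
      StdCong.of_eq ?_ <;>
    apply Cell3.ext_raw <;> simp [h']

end Prepolygraph4

/-! ### First moves, and confluence under symmetry and contexts -/

/-- The first move is a prefix of the interchange 3-cell. -/
theorem Interchanger.exists_firstMove_comp {P : Prepolygraph3.{u}} (X : Interchanger P)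
    {x y z : P.Obj} {φ φ₀ : Cell2 P.toPrepolygraph2 x y} {w : Whisker2 P.toPrepolygraph2 x y}
    {v : Whisker2 P.toPrepolygraph2 y z} {ψ ψ₀ : Cell2 P.toPrepolygraph2 y z}
    (h₁ : φ₀.tgt = w.src) (h₂ : v.tgt = ψ₀.src) (hφ : φ = φ₀.comp w.toCell (by simp [h₁]))
    (hψ : ψ = v.toCell.comp ψ₀ (by simp [h₂])) :
    ∃ (G : Cell3 P x z) (h : (X.firstMove φ₀ w v ψ₀ h₁ h₂).tgt = G.src),
      (X.firstMove φ₀ w v ψ₀ h₁ h₂).comp G h = X.cell φ ψ := by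
  subst hφ hψ
  -- After `w` has crossed `v`, it still has to cross `ψ₀`, and then `φ₀` crosses all of `v ∘₁ ψ₀`.
  refine ⟨(Cell3.pre ((Cell2.whisk Quiver.Path.nil φ₀ v.src).comp
      (Cell2.whisk w.src v.toCell Quiver.Path.nil) (by simp [h₁])) (X.row w ψ₀)
      (by simp [h₂])).comp
    (Cell3.post (X.cell φ₀ (v.toCell.comp ψ₀ (by simp [h₂])))
      (Cell2.whisk Quiver.Path.nil w.toCell ψ₀.tgt) (by simp [h₁])) ?_, ?_, ?_⟩
  · apply FreeMor.ext' <;> simp [h₁]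
  · apply FreeMor.ext' <;> simp [h₂, firstMove]
  · apply Cell3.ext_raw <;>
      simp [firstMove, cell_comp_edge_raw, Function.comp_def, -whiskerCell_raw]

theorem RewritingSystem.IsConfluentBranching.symm {P : Prepolygraph3.{u}}
    {R : RewritingSystem P} {x y : P.Obj} {F₁ F₂ : Cell3 P x y}
    (h : R.IsConfluentBranching F₁ F₂) : R.IsConfluentBranching F₂ F₁ := by
  obtain ⟨G₁, G₂, h₁, h₂, h₃, h₄⟩ := h
  exact ⟨G₂, G₁, h₂, h₁, h₃.symm, R.isCongruence.symm h₄⟩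

theorem RewritingSystem.isConfluentBranching_self {P : Prepolygraph3.{u}}
    (R : RewritingSystem P) {x y : P.Obj} (F : Cell3 P x y) : R.IsConfluentBranching F F :=
  ⟨Cell3.id F.tgt, Cell3.id F.tgt, rfl, rfl, rfl, R.isCongruence.refl _⟩

/-- Confluence is preserved by contexts. -/
theorem RewritingSystem.IsConfluentBranching.ctx_whisk {P : Prepolygraph3.{u}}
    {R : RewritingSystem P} {x y a b : P.Obj} {F₁ F₂ : Cell3 P a b}
    (h : R.IsConfluentBranching F₁ F₂) (l : Cell1 P.toPrepolygraph1 x a)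
    (r : Cell1 P.toPrepolygraph1 b y) (lam rho : Cell2 P.toPrepolygraph2 x y)
    (h₁ : lam.tgt = (Cell3.whisk l F₁ r).src.src) (h₂ : (Cell3.whisk l F₁ r).src.tgt = rho.src)
    (h₁' : lam.tgt = (Cell3.whisk l F₂ r).src.src)
    (h₂' : (Cell3.whisk l F₂ r).src.tgt = rho.src) :
    R.IsConfluentBranching (Cell3.ctx lam (Cell3.whisk l F₁ r) rho h₁ h₂)
      (Cell3.ctx lam (Cell3.whisk l F₂ r) rho h₁' h₂') := by
  obtain ⟨G₁, G₂, h₃, h₄, h₅, h₆⟩ := h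
  refine ⟨Cell3.ctx lam (Cell3.whisk l G₁ r) rho (by simpa [← h₃] using h₁)
    (by simpa [← h₃] using h₂), Cell3.ctx lam (Cell3.whisk l G₂ r) rho
    (by simpa [← h₄] using h₁') (by simpa [← h₄] using h₂'), ?_, ?_, ?_, ?_⟩
  · apply FreeMor.ext' <;> simp [h₃]
  · apply FreeMor.ext' <;> simp [h₄]
  · apply FreeMor.ext' <;> simp [h₅]
  · have key := R.isCongruence.ctx lam rho (by simpa using h₁) (by simpa using h₂)
      (by simpa using h₁') (by simpa using h₂') (R.isCongruence.whisk l r h₆)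
    -- The context distributes over `∘₂`, so it splits into the context of the branching and that of
    -- the closing cells.
    simp only [Cell3.whisk_comp] at key
    rwa [Cell3.ctx_comp, Cell3.ctx_comp] at key

/-! ### Confluence of independent and natural branchings -/

namespace GrayPresentation

variable {Q : GrayPresentation.{u}}

theorem isConfluentBranching_of_isIndependent {x y : Q.Obj}
    {S₁ S₂ : Cell3 Q.toPrepolygraph3 x y} (h : IsIndependent S₁ S₂) :
    Q.rewritingSystem.IsConfluentBranching S₁ S₂ := by
  obtain ⟨_, _, _, _, l₁, A₁, r₁, χ, l₂, A₂, r₂, h₁, h₂, rfl, rfl⟩ := h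
  obtain ⟨G, hG₁, hG₂⟩ := Q.hasIndependence l₁ A₁ r₁ χ l₂ A₂ r₂ h₁ h₂
  have hp := Q.tgt_src4 G
  have key := Prepolygraph4.StdCong.gen G
  rw [hG₁, hG₂] at key hp
  exact ⟨Cell3.actBot l₁ (Q.tgt3 A₁) r₁ χ l₂ A₂ r₂ (by simp [h₁]) h₂,
    Cell3.actTop l₁ A₁ r₁ χ l₂ (Q.tgt3 A₂) r₂ h₁ (by simp [h₂]), _, _, hp.symm, key⟩

/-- The naturality square closes the branching: one side starts with `S₁`, the other with an
interchange 3-cell whose first move is `S₂`. -/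
theorem isConfluentBranching_of_isNatural {x y : Q.Obj}
    {S₁ S₂ : Cell3 Q.toPrepolygraph3 x y} (h : Q.IsNatural S₁ S₂) :
    Q.rewritingSystem.IsConfluentBranching S₁ S₂ := by
  rcases h with ⟨_, _, A, g, ψ, φ₀, w, v, ψ₀, h₁, h₂, hφ, hψ, rfl, rfl⟩ |
    ⟨_, _, φ, g, B, φ₀, w, v, ψ₀, h₁, h₂, hφ, hψ, rfl, rfl⟩
  · have key := Prepolygraph4.naturality_left Q.X Q.hasIndependence Q.hasNaturalityLeft A
      (Cell2.whisk g ψ Quiver.Path.nil)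
    obtain ⟨G, hG, hG'⟩ := Q.X.exists_firstMove_comp h₁ h₂ hφ hψ
    have hG'' := congrArg FreeMor.tgt hG'
    rw [FreeMor.comp_tgt] at hG''
    have h₃ : G.tgt = ((Cell3.ofGen A).rlLeft (Cell2.whisk g ψ Quiver.Path.nil)).src := by
      simp [hG'']
    -- `S₁` is followed by the interchange 3-cell at the target of `A`. `S₂` is followed by the
    -- remaining moves `G` of the one at the source of `A`, and then by `A` on the far side.
    refine ⟨_, G.comp _ h₃, _, hG, ?_, key.trans (.of_eq ?_)⟩
    · simp
    · simp only [← hG']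
      exact Cell3.comp_assoc _ _ _ _ _
  · have key := Prepolygraph4.naturality_right Q.X Q.hasNaturalityRight
      (Cell2.whisk Quiver.Path.nil φ g) B
    obtain ⟨G, hG, hG'⟩ := Q.X.exists_firstMove_comp h₁ h₂ hφ hψ
    have hG'' := congrArg FreeMor.tgt hG'
    rw [FreeMor.comp_tgt] at hG''
    have h₃ : G.tgt =
        (Cell3.rlRight (Cell2.whisk Quiver.Path.nil φ g) (Cell3.ofGen B)).src := by
      simp [hG'']
    refine ⟨_, G.comp _ h₃, _, hG, ?_, key.trans (.of_eq ?_)⟩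
    · simp
    · simp only [← hG']
      exact Cell3.comp_assoc _ _ _ _ _

end GrayPresentation

/-! ### Reduction to minimal branchings -/

theorem Cell1.isId_of_length {P : Prepolygraph1.{u}} {x y : P.Obj} (f : Cell1 P x y)
    (h : f.length = 0) : f.IsId := by
  cases f with
  | nil => exact .nil _
  | cons f e => simp at h

/-- A property of local branchings that is stable under contexts holds if it holds for minimal local
branchings. -/
theorem IsLocalBranching.induction {P : Prepolygraph3.{u}}
    {motive : ∀ {x y : P.Obj}, Cell3 P x y → Cell3 P x y → Prop}
    (minimal : ∀ {x y : P.Obj} (S₁ S₂ : Cell3 P x y), IsLocalBranching S₁ S₂ → IsMinimal S₁ S₂ →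
      motive S₁ S₂)
    (ctx : ∀ {x y a b : P.Obj} (T₁ T₂ : Cell3 P a b) (l : Cell1 P.toPrepolygraph1 x a)
      (r : Cell1 P.toPrepolygraph1 b y) (lam rho : Cell2 P.toPrepolygraph2 x y)
      (h₁ : lam.tgt = (Cell3.whisk l T₁ r).src.src)
      (h₂ : (Cell3.whisk l T₁ r).src.tgt = rho.src)
      (h₁' : lam.tgt = (Cell3.whisk l T₂ r).src.src)
      (h₂' : (Cell3.whisk l T₂ r).src.tgt = rho.src), motive T₁ T₂ →
      motive (Cell3.ctx lam (Cell3.whisk l T₁ r) rho h₁ h₂)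
        (Cell3.ctx lam (Cell3.whisk l T₂ r) rho h₁' h₂'))
    {x y : P.Obj} (S₁ S₂ : Cell3 P x y) (h : IsLocalBranching S₁ S₂) : motive S₁ S₂ := by
  -- Lexicographic induction on the number `n` of whiskers in the common 2-source and the length `m`
  -- of its 1-source. The order matters: removing a nontrivial `λ` lowers `n` but may raise `m`,
  -- since the 1-source of `λ` can be shorter than its 1-target.
  suffices ∀ (n m : ℕ) {x y : P.Obj} (S₁ S₂ : Cell3 P x y), IsLocalBranching S₁ S₂ →
      S₁.src.steps.length = n → S₁.src.src.length = m → motive S₁ S₂ from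
    this _ _ S₁ S₂ h rfl rfl
  intro n
  induction n using Nat.strong_induction_on with
  | _ n ihn =>
  intro m
  induction m using Nat.strong_induction_on with
  | _ m ihm =>
  intro x y S₁ S₂ hS hn hm
  by_cases hmin : IsMinimal S₁ S₂
  · exact minimal S₁ S₂ hS hmin
  simp only [IsMinimal, not_forall] at hmin
  obtain ⟨a, b, T₁, T₂, hT, l, r, lam, rho, h₁, h₂, h₁', h₂', rfl, rfl, hne⟩ := hmin
  refine ctx T₁ T₂ l r lam rho h₁ h₂ h₁' h₂' ?_
  simp only [Cell3.ctx_src, Cell2.ctx_steps, Cell2.ctx_src, Cell3.whisk_src, Cell2.whisk_steps,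
    List.length_append, List.length_map] at hn hm
  by_cases hlen : lam.steps = [] ∧ rho.steps = []
  · have hlam := FreeMor.eq_id hlen.1
    -- With `λ` an identity, the 1-source of the whole is that of `T₁` whiskered by `l` and `r`, so
    -- lengths add. If `m` did not drop, `l` and `r` would have length 0 and the whole context would
    -- be trivial, against `hne`.
    have hsrc : lam.src = l.comp (T₁.src.src.comp r) := by
      rw [hlam] at h₁
      exact h₁
    have hm' : l.length + (T₁.src.src.length + r.length) = m := by
      rw [← hm, hsrc, Quiver.Path.length_comp, Quiver.Path.length_comp]
    refine ihm T₁.src.src.length ?_ T₁ T₂ hT (by simpa [hlen.1, hlen.2] using hn) rfl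
    by_contra hlt
    exact hne ⟨l.isId_of_length (by omega), r.isId_of_length (by omega), hlam,
      FreeMor.eq_id hlen.2⟩
  · refine ihn T₁.src.steps.length ?_ T₁.src.src.length T₁ T₂ hT rfl rfl
    by_contra hlt
    exact hlen ⟨List.length_eq_zero_iff.1 (by omega), List.length_eq_zero_iff.1 (by omega)⟩

end GrayRewriting

/-! ### The critical pair lemma -/

/-- The adapted critical pair lemma. -/
theorem mainTheorem5 (Q : GrayRewriting.GrayPresentation.{u}) :
    Q.rewritingSystem.IsLocallyConfluent ↔
      ∀ {x y : Q.Obj} (S₁ S₂ : GrayRewriting.Cell3 Q.toPrepolygraph3 x y),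
        Q.IsCritical S₁ S₂ → Q.rewritingSystem.IsConfluentBranching S₁ S₂ := by
  refine ⟨fun h x y S₁ S₂ hS => h S₁ S₂ hS.isLocalBranching, fun h x y S₁ S₂ hS => ?_⟩
  refine hS.induction (motive := fun S₁ S₂ => Q.rewritingSystem.IsConfluentBranching S₁ S₂) ?_
    (fun _ _ l r lam rho h₁ h₂ h₁' h₂' hT => hT.ctx_whisk l r lam rho h₁ h₂ h₁' h₂') S₁ S₂
  intro x y S₁ S₂ hS hmin
  -- A minimal branching that is not confluent is critical, since each class excluded in
  -- `IsCritical` consists of confluent branchings. The hypothesis `h` then makes it confluent.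
  by_contra hconf
  refine hconf (h S₁ S₂ ⟨hS, hmin, ?_, ?_, ?_, ?_, ?_⟩)
  · rintro rfl
    exact hconf (GrayRewriting.RewritingSystem.isConfluentBranching_self _ S₁)
  · exact fun hi => hconf (GrayRewriting.GrayPresentation.isConfluentBranching_of_isIndependent hi)
  · exact fun hi =>
      hconf (GrayRewriting.GrayPresentation.isConfluentBranching_of_isIndependent hi).symm
  · exact fun hi => hconf (GrayRewriting.GrayPresentation.isConfluentBranching_of_isNatural hi)
  · exact fun hi =>
      hconf (GrayRewriting.GrayPresentation.isConfluentBranching_of_isNatural hi).symm
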